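/- Let $G$ be a finite simple planar graph, $C$ a finite set of colours and $\chi:V(G)\to 2^C$; for a walk $W$ let $\chi(W)$ be the union of $\chi(w)$ over the vertices $w$ of $W$, and call $W$ $k$-valid if $|\chi(W)|\le k$. Assume that for every colour $c$ the set $\{w: c\in\chi(w)\}$ induces a connected subgraph (or is empty) and that no two adjacent vertices have the same colour set. Let $s,t,v\in V(G)$, $U\subseteq V(G)$, $k\in\mathbb N$, and let $b\ge 1$ be an integer. Let $\mathbf Q'$ be a finite set of $k$-valid $s$–$v$ paths whose colour sets are pairwise disjoint, all of which contain every vertex of $U$ and visit the vertices of $U$ in the same order. Suppose that no $b$ paths of $\mathbf Q'$ share a vertex of $V(G)\setminus(U\cup\{s,v\})$, and that $|\mathbf Q'|>(8k^2+8k+2)(|U|+1)\,b$. Then there is a path $P\in\mathbf Q'$ such that $\chi(P)\cap\chi(Q)=\emptyset$ for every $k$-valid $v$–$t$ walk $Q$ that contains no vertex of $U\cup\{s,v\}$ apart from its starting vertex $v$. Moreover, such a path can be found in polynomial time: a single algorithm (a random access machine with addition and subtraction, every instruction counting one step), given $G,\chi,s,t,v,k,b,U$ and a list of the paths in $\mathbf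 Q'$, outputs such a $P$ in time bounded by a fixed polynomial in the length of the input (no drawing of $G$ is given). -/

import Mathlib

/-! ### Coloured graphs -/

namespace ColoredPath


/-- A drawing of a graph in the plane without edge intersections: vertices are distinct points, every
edge is a simple arc joining its two ends, an arc contains no vertex other than its ends, and two
different arcs meet only in vertices. -/
structure PlaneDrawing {V : Type*} (G : SimpleGraph V) where
  pos : V → EuclideanSpace ℝ (Fin 2)
  pos_injective : Function.Injective pos
  arc : G.edgeSet → unitInterval → EuclideanSpace ℝ (Fin 2)
  arc_continuous : ∀ e, Continuous (arc e)
  arc_injective : ∀ e, Function.Injective (arc e)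
  arc_ends : ∀ e : G.edgeSet, s(arc e 0, arc e 1) = Sym2.map pos e.1
  arc_vertex : ∀ (e : G.edgeSet) (w : V), pos w ∈ Set.range (arc e) → w ∈ e.1
  arc_inter : ∀ e f : G.edgeSet, e ≠ f → Set.range (arc e) ∩ Set.range (arc f) ⊆ Set.range pos

/-- A graph is planar if it can be drawn in the plane without edge intersections. -/
def Planar {V : Type*} (G : SimpleGraph V) : Prop := Nonempty (PlaneDrawing G)

/-- Every colour is connected: the vertices carrying it induce a connected subgraph (a colour that
appears on no vertex is harmless). -/
def ColorConnected {V C : Type*} (G : SimpleGraph V) (χ : V → Finset C) : Prop :=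
  ∀ c : C, (G.induce {w | c ∈ χ w}).Preconnected

/-- No colour contraction applies: there are no two adjacent vertices with the same colour set. -/
def ColorIrreducible {V C : Type*} (G : SimpleGraph V) (χ : V → Finset C) : Prop :=
  ∀ x y : V, G.Adj x y → χ x ≠ χ y

/-- The set `χ(W)` of the colours that appear on the vertices of a walk. -/
def walkColors {V C : Type*} [DecidableEq V] [DecidableEq C] {G : SimpleGraph V}
    (χ : V → Finset C) {x y : V} (W : G.Walk x y) : Finset C :=
  W.support.toFinset.biUnion χ

/-- A walk is `k`-valid if at most `k` colours appear on it. -/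
def IsValid {V C : Type*} [DecidableEq V] [DecidableEq C] {G : SimpleGraph V}
    (χ : V → Finset C) (k : ℕ) {x y : V} (W : G.Walk x y) : Prop :=
  (walkColors χ W).card ≤ k

/-- The data of the search problem: a graph on `n` vertices, coloured with subsets of a set of `m`
colours, vertices `s`, `t`, `v`, numbers `k` and `b`, a vertex set `U`, and a list of `s`-`v` paths. -/
structure Instance (n m : ℕ) where
  G : SimpleGraph (Fin n)
  χ : Fin n → Finset (Fin m)
  s : Fin n
  t : Fin n
  v : Fin n
  k : ℕ
  b : ℕ
  U : Finset (Fin n)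
  paths : List (G.Path s v)

/-- What is assumed of the input. -/
structure Instance.Admissible {n m : ℕ} (I : Instance n m) : Prop where
  planar : Planar I.G
  colorConnected : ColorConnected I.G I.χ
  irreducible : ColorIrreducible I.G I.χ
  b_pos : 0 < I.b
  /-- the list enumerates a set of paths -/
  nodup : I.paths.Nodup
  valid : ∀ P ∈ I.paths, IsValid I.χ I.k P.1
  colorDisjoint : I.paths.Pairwise fun P P' => Disjoint (walkColors I.χ P.1) (walkColors I.χ P'.1)
  visits : ∀ P ∈ I.paths, ∀ u ∈ I.U, u ∈ P.1.support
  /-- all paths visit the vertices of `U` in the same order -/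
  sameOrder : ∀ P ∈ I.paths, ∀ P' ∈ I.paths,
    P.1.support.filter (fun w => w ∈ I.U) = P'.1.support.filter (fun w => w ∈ I.U)
  /-- no `b` of the paths share a vertex outside `U ∪ {s, v}` -/
  fewShare : ∀ w : Fin n, w ∉ I.U → w ≠ I.s → w ≠ I.v →
    I.paths.countP (fun P => w ∈ P.1.support) < I.b
  many : (8 * I.k ^ 2 + 8 * I.k + 2) * (I.U.card + 1) * I.b < I.paths.length

open Classical in
/-- The input as a list of numbers: the parameters, the adjacency matrix, the matrix of the colouring,
the indicator vector of `U`, and the paths, each as its number of vertices followed by its vertices. -/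
noncomputable def Instance.encode {n m : ℕ} (I : Instance n m) : List ℕ :=
  [n, m, I.s.val, I.t.val, I.v.val, I.k, I.b, I.paths.length]
  ++ (List.finRange n).flatMap (fun i => (List.finRange n).map fun j => if I.G.Adj i j then 1 else 0)
  ++ (List.finRange n).flatMap (fun i => (List.finRange m).map fun c => if c ∈ I.χ i then 1 else 0)
  ++ (List.finRange n).map (fun i => if i ∈ I.U then 1 else 0)
  ++ I.paths.flatMap (fun P => P.1.support.length :: P.1.support.map Fin.val)

end ColoredPath

/-! ### Random access machines -/

namespace RAM

/-- Programs of a random access machine. A program mentions finitely many registers; the memory is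
accessed through addresses held in registers. There is no multiplication, so that counting every
instruction as one step agrees, up to a polynomial, with the running time of a Turing machine. -/
inductive Prog : Type
  | const (x a : ℕ)
  | add (x y z : ℕ)
  | sub (x y z : ℕ)
  | load (x y : ℕ)
  | store (x y : ℕ)
  | seq (c d : Prog)
  | ifNonzero (x : ℕ) (c d : Prog)
  | whileNonzero (x : ℕ) (c : Prog)

structure State where
  reg : ℕ → ℕ
  mem : ℕ → ℕ

/-- `Exec c σ σ' T`: started in `σ`, the program `c` halts in `σ'` after `T` steps, where an elementary
instruction and a test of a register are one step each. -/
inductive Exec : Prog → State → State → ℕ → Prop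
  | const (x a : ℕ) (σ : State) :
      Exec (.const x a) σ ⟨Function.update σ.reg x a, σ.mem⟩ 1
  | add (x y z : ℕ) (σ : State) :
      Exec (.add x y z) σ ⟨Function.update σ.reg x (σ.reg y + σ.reg z), σ.mem⟩ 1
  | sub (x y z : ℕ) (σ : State) :
      Exec (.sub x y z) σ ⟨Function.update σ.reg x (σ.reg y - σ.reg z), σ.mem⟩ 1
  | load (x y : ℕ) (σ : State) :
      Exec (.load x y) σ ⟨Function.update σ.reg x (σ.mem (σ.reg y)), σ.mem⟩ 1
  | store (x y : ℕ) (σ : State) :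
      Exec (.store x y) σ ⟨σ.reg, Function.update σ.mem (σ.reg x) (σ.reg y)⟩ 1
  | seq {c d : Prog} {σ σ' σ'' : State} {T T' : ℕ} :
      Exec c σ σ' T → Exec d σ' σ'' T' → Exec (.seq c d) σ σ'' (T + T')
  | ifTrue {x : ℕ} {c d : Prog} {σ σ' : State} {T : ℕ} :
      σ.reg x ≠ 0 → Exec c σ σ' T → Exec (.ifNonzero x c d) σ σ' (T + 1)
  | ifFalse {x : ℕ} {c d : Prog} {σ σ' : State} {T : ℕ} :
      σ.reg x = 0 → Exec d σ σ' T → Exec (.ifNonzero x c d) σ σ' (T + 1)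
  | whileStop {x : ℕ} {c : Prog} {σ : State} :
      σ.reg x = 0 → Exec (.whileNonzero x c) σ σ 1
  | whileStep {x : ℕ} {c : Prog} {σ σ' σ'' : State} {T T' : ℕ} :
      σ.reg x ≠ 0 → Exec c σ σ' T → Exec (.whileNonzero x c) σ' σ'' T' →
      Exec (.whileNonzero x c) σ σ'' (T + 1 + T')

/-- The initial state: the input is in the memory cells `0, 1, …`, its length is in register `0`, and
everything else is `0`. -/
def init (input : List ℕ) : State where
  reg := Function.update (fun _ => 0) 0 input.length
  mem := fun i => input.getD i 0

end RAM

/-! ### Winding of plane curves and the non-planarity of `K₅` and `K₃,₃` -/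

namespace PlaneCurves

open Complex

/-! Call the vertices of `U ∪ {s, v}` forbidden. They lie on all paths of the list, and there are at
least two paths, with disjoint colour sets; so forbidden vertices are uncoloured. By irreducibility
no two uncoloured vertices are adjacent.

Search outward from `t`, alternating between vertices and colours (`front`, `marked`). A `k`-valid
walk that starts at `t` and avoids forbidden vertices can be followed by jumping to the last vertex
of a current colour and stepping on to the next coloured vertex. Each jump uses up a colour, so all
its colours are marked at index `k - 1` (`marked_of_walk_start`). Hence a path without marked
colours shares no colour with any of the walks `Q` (`disjoint_of_unmarked`), and it remains to see
that one exists (`exists_unmarked`).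

Suppose every path has a marked colour, on a vertex `y` of it. Let `R` be the open segment of the
path around `y` between consecutive forbidden vertices `u`, `u'`. The search gives a connection `T`
from `t` to `y` made of at most `k` colour classes and `k` further vertices; the colours of the path
give a bypass `Γ` of `R` with at most `k - 1` further vertices (`exists_skeleton`). Since a colour
is on at most one path and an allowed vertex on fewer than `b`, the set `Γ ∪ T` touches at most
`(2k-1)b` other paths. By pigeonhole many paths have the same `u`, hence the same `u'`, and a
digraph of small outdegree has a large independent set: this leaves six paths whose `Γ` and `T`
avoid each other's `R` (`exists_independent`).

The segments `R` may still meet, so Ramsey's theorem is applied to them (`Planar.not_six`). Three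
disjoint ones give a `K₃,₃` between `u`, `u'`, `t` and the vertices `y`. Three that meet pairwise
give a `K₅` on `u`, `u'` and the three neighbours of `u`, with `u` and `u'` joined by the bypass of
a fourth path. In both cases independent edges lie in disjoint vertex sets, which a parity count of
winding numbers excludes in the plane (`no_K5`, `no_K33`).

The algorithm is this search followed by a scan of the paths; it needs no drawing. Its loops run
over vertices, colours, paths and `k` rounds, all bounded by the input length. -/

theorem exists_continuous_log {A : Type*} [TopologicalSpace A] [SimplyConnectedSpace A]
    [LocallyPathConnectedSpace A] (f : A → ℂ) (hf : Continuous f) (h0 : ∀ a, f a ≠ 0) :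
    ∃ l : A → ℂ, Continuous l ∧ ∀ a, exp (l a) = f a := by
  obtain ⟨a₀⟩ : Nonempty A := inferInstance
  obtain ⟨l, hl, -⟩ := isCoveringMapOn_exp.existsUnique_continuousMap_lifts
    (f := ⟨f, hf⟩) (a₀ := a₀) (e₀ := log (f a₀)) (by simp [exp_log (h0 a₀)]) (fun a => by simpa using h0 a)
  exact ⟨l, l.continuous, fun a => congrFun hl.2 a⟩

/-- By uniqueness of lifts through `exp`, two continuous logarithms of one function differ by a
constant. This makes `turn` independent of the choice in it. -/
theorem log_increment_unique {l₁ l₂ : ℝ → ℂ} (h₁ : Continuous l₁) (h₂ : Continuous l₂)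
    (h : ∀ t, exp (l₁ t) = exp (l₂ t)) : l₁ 1 - l₁ 0 = l₂ 1 - l₂ 0 := by
  have hu := isCoveringMapOn_exp.existsUnique_continuousMap_lifts
    (f := ⟨fun t => exp (l₁ t), by fun_prop⟩) (a₀ := (0 : ℝ)) (e₀ := l₁ 0) rfl (fun a => by simp)
  have he : exp (l₁ 0 - l₂ 0) = 1 := by rw [exp_sub, h 0, div_self (exp_ne_zero _)]
  have := hu.unique (y₁ := ⟨l₁, h₁⟩) (y₂ := ⟨fun t => l₂ t + (l₁ 0 - l₂ 0), by fun_prop⟩)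
    ⟨rfl, rfl⟩ ⟨by simp, by ext t; simp [exp_add, he, h]⟩
  have := DFunLike.congr_fun this (1 : ℝ)
  simp only [ContinuousMap.coe_mk] at this
  rw [this]; ring

open Classical in
/-- The total change of a continuous logarithm of `f` over `[0, 1]`. -/
noncomputable def turn (f : ℝ → ℂ) : ℂ :=
  if h : ∃ l : ℝ → ℂ, Continuous l ∧ ∀ t, exp (l t) = f t then h.choose 1 - h.choose 0 else 0

theorem turn_eq {f l : ℝ → ℂ} (hl : Continuous l) (h : ∀ t, exp (l t) = f t) :
    turn f = l 1 - l 0 := by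
  have hex : ∃ l : ℝ → ℂ, Continuous l ∧ ∀ t, exp (l t) = f t := ⟨l, hl, h⟩
  rw [turn, dif_pos hex]
  exact log_increment_unique hex.choose_spec.1 hl fun t => by rw [hex.choose_spec.2, h]

/-- The function `d r - g s` has no zero on the parameter plane, which is simply connected, so it
has a continuous logarithm there. Both sides are its increment from `(0, 0)` to `(1, 1)`, along the
two ways round the unit square. -/
theorem turn_square {g d : ℝ → ℂ} (hg : Continuous g) (hd : Continuous d)
    (h : ∀ s r, g s ≠ d r) :
    turn (fun r => d r - g 0) + turn (fun s => g s - d 1) =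
      turn (fun s => g s - d 0) + turn (fun r => d r - g 1) := by
  obtain ⟨l, hl, he⟩ := exists_continuous_log (A := ℝ × ℝ) (fun p => d p.2 - g p.1) (by fun_prop)
    (fun p => sub_ne_zero.2 (h p.1 p.2).symm)
  have hd' : ∀ s, turn (fun r => d r - g s) = l (s, 1) - l (s, 0) := fun s =>
    turn_eq (l := fun r => l (s, r)) (by fun_prop) fun r => he (s, r)
  -- Changing the sign adds `π I` to the logarithm, and this constant cancels in the increment.
  have hg' : ∀ r, turn (fun s => g s - d r) = l (1, r) - l (0, r) := fun r => by
    rw [turn_eq (l := fun s => l (s, r) + Real.pi * I) (by fun_prop)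
      fun s => by rw [exp_add, he (s, r), exp_pi_mul_I]; ring]
    ring
  rw [hd', hd', hg', hg']; ring

/-- The ends of the curve determine the turn up to a multiple of `2πi`. The hypotheses stand behind
the quantifier so that `choose` yields a function of all points and curves. -/
theorem exists_turn_int (x : ℂ) (d : ℝ → ℂ) : ∃ N : ℤ, Continuous d → (∀ t, x ≠ d t) →
    turn (fun t => d t - x) = log (d 1 - x) - log (d 0 - x) + N * (2 * Real.pi * I) := by
  by_cases hd : Continuous d ∧ ∀ t, x ≠ d t
  · obtain ⟨hd, hx⟩ := hd
    have h0 : ∀ t, d t - x ≠ 0 := fun t => sub_ne_zero.2 (hx t).symm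
    obtain ⟨l, hl, he⟩ := exists_continuous_log (fun t => d t - x) (by fun_prop) h0
    obtain ⟨n, hn⟩ := exp_eq_exp_iff_exists_int.1 ((he 1).trans (exp_log (h0 1)).symm)
    obtain ⟨n', hn'⟩ := exp_eq_exp_iff_exists_int.1 ((he 0).trans (exp_log (h0 0)).symm)
    refine ⟨n - n', fun _ _ => ?_⟩
    rw [turn_eq hl he, hn, hn']; push_cast; ring
  · exact ⟨0, fun h h' => absurd ⟨h, h'⟩ hd⟩

theorem exists_log_neg_int (a b : ℂ) : ∃ E : ℤ, a ≠ b →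
    log (b - a) - log (a - b) = (2 * E + 1) * (Real.pi * I) := by
  by_cases h : a = b
  · exact ⟨0, fun h' => absurd h h'⟩
  have : exp (log (b - a)) = exp (log (a - b) + Real.pi * I) := by
    rw [exp_add, exp_log (sub_ne_zero.2 (Ne.symm h)), exp_log (sub_ne_zero.2 h), exp_pi_mul_I]; ring
  obtain ⟨n, hn⟩ := exp_eq_exp_iff_exists_int.1 this
  exact ⟨n, fun _ => by rw [hn]; ring⟩

/-- The integer data of a system of plane curves: each pair of disjoint curves gives a linear relation. -/
theorem exists_curve_relations : ∃ (N : ℂ → (ℝ → ℂ) → ℤ) (E : ℂ → ℂ → ℤ),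
    (∀ a b, a ≠ b → E b a = - E a b - 1) ∧
    ∀ g d : ℝ → ℂ, Continuous g → Continuous d → (∀ s r, g s ≠ d r) →
      E (g 0) (d 1) - E (g 0) (d 0) + E (d 1) (g 1) - E (d 0) (g 1)
        + N (g 0) d + N (d 1) g - N (d 0) g - N (g 1) d = 0 := by
  choose N hN using exists_turn_int
  choose E hE using exists_log_neg_int
  have hpi : (Real.pi * I : ℂ) ≠ 0 := by simp [Real.pi_ne_zero]
  refine ⟨N, E, fun a b h => ?_, fun g d hg hd h => ?_⟩
  · have h1 := hE a b h
    have h2 := hE b a h.symm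
    have : ((2 * E a b + 1) + (2 * E b a + 1) : ℂ) * (Real.pi * I) = 0 := by
      linear_combination -h1 - h2
    have := (mul_eq_zero.1 this).resolve_right hpi
    norm_cast at this
    omega
  · have h1 := hN (g 0) d hd fun t => h 0 t
    have h2 := hN (g 1) d hd fun t => h 1 t
    have h3 := hN (d 0) g hg fun t => (h t 0).symm
    have h4 := hN (d 1) g hg fun t => (h t 1).symm
    have e1 := hE (g 0) (d 1) (h 0 1)
    have e2 := hE (g 0) (d 0) (h 0 0)
    have e3 := hE (d 1) (g 1) (h 1 1).symm
    have e4 := hE (d 0) (g 1) (h 1 0).symm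
    have hs := turn_square hg hd h
    rw [h1, h2, h3, h4] at hs
    have : ((E (g 0) (d 1) - E (g 0) (d 0) + E (d 1) (g 1) - E (d 0) (g 1)
        + N (g 0) d + N (d 1) g - N (d 0) g - N (g 1) d : ℤ) : ℂ) * (2 * (Real.pi * I)) = 0 := by
      push_cast
      linear_combination hs - e1 + e2 - e3 + e4
    have := (mul_eq_zero.1 this).resolve_right (by simp)
    exact_mod_cast this

theorem JoinedIn.exists_curve {S : Set ℂ} {x y : ℂ} (h : JoinedIn S x y) :
    ∃ g : ℝ → ℂ, Continuous g ∧ g 0 = x ∧ g 1 = y ∧ ∀ t, g t ∈ S :=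
  ⟨h.somePath.extend, h.somePath.continuous_extend, by simp, by simp, fun t => by
    obtain ⟨r, hr⟩ : h.somePath.extend t ∈ Set.range h.somePath := by
      rw [← Path.extend_range]; exact ⟨t, rfl⟩
    rw [← hr]; exact h.somePath_mem r⟩

/-- The complete graph on five vertices cannot be mapped to the plane so that independent edges
have disjoint images. -/
theorem no_K5 (p : Fin 5 → ℂ) (S : Fin 5 → Fin 5 → Set ℂ)
    (hS : ∀ i j, i < j → JoinedIn (S i j) (p i) (p j))
    (hd : ∀ i j k l, i < j → k < l → i < k → j ≠ k → j ≠ l → Disjoint (S i j) (S k l)) :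
    False := by
  obtain ⟨N, E, hE, hR⟩ := exists_curve_relations
  have hS' : ∀ i j, ∃ g : ℝ → ℂ, i < j → Continuous g ∧ g 0 = p i ∧ g 1 = p j ∧ ∀ t, g t ∈ S i j := by
    intro i j
    by_cases h : i < j
    · obtain ⟨g, hg⟩ := JoinedIn.exists_curve (hS i j h)
      exact ⟨g, fun _ => hg⟩
    · exact ⟨0, fun h' => absurd h' h⟩
  choose g hg using hS'
  have key : ∀ i j k l, i < j → k < l → i < k → j ≠ k → j ≠ l →
      E (p i) (p l) - E (p i) (p k) + E (p l) (p j) - E (p k) (p j)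
        + N (p i) (g k l) + N (p l) (g i j) - N (p k) (g i j) - N (p j) (g k l) = 0 := by
    intro i j k l h1 h2 h3 h5 h6
    obtain ⟨c, e0, e1, hm⟩ := hg i j h1
    obtain ⟨c', e0', e1', hm'⟩ := hg k l h2
    have := hR _ _ c c' fun s r h =>
      Set.disjoint_left.1 (hd i j k l h1 h2 h3 h5 h6) (hm s) (h ▸ hm' r)
    rwa [e0, e1, e0', e1'] at this
  have hp : ∀ i j k l, i < j → k < l → i < k → j ≠ k → j ≠ l →
      E (p l) (p j) = - E (p j) (p l) - 1 ∧ E (p k) (p j) = - E (p j) (p k) - 1 := by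
    intro i j k l h1 h2 h3 h5 h6
    obtain ⟨c, e0, e1, hm⟩ := hg i j h1
    obtain ⟨c', e0', e1', hm'⟩ := hg k l h2
    have hdis := Set.disjoint_left.1 (hd i j k l h1 h2 h3 h5 h6) (hm 1)
    exact ⟨hE _ _ fun h => hdis (by rw [e1, h, ← e1']; exact hm' 1),
      hE _ _ fun h => hdis (by rw [e1, h, ← e0']; exact hm' 0)⟩
  have k1 := key 0 1 2 3 (by decide) (by decide) (by decide) (by decide) (by decide)
  have k2 := key 0 2 1 3 (by decide) (by decide) (by decide) (by decide) (by decide)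
  have k3 := key 0 3 1 2 (by decide) (by decide) (by decide) (by decide) (by decide)
  have k4 := key 0 1 2 4 (by decide) (by decide) (by decide) (by decide) (by decide)
  have k5 := key 0 2 1 4 (by decide) (by decide) (by decide) (by decide) (by decide)
  have k6 := key 0 4 1 2 (by decide) (by decide) (by decide) (by decide) (by decide)
  have k7 := key 0 1 3 4 (by decide) (by decide) (by decide) (by decide) (by decide)
  have k8 := key 0 3 1 4 (by decide) (by decide) (by decide) (by decide) (by decide)
  have k9 := key 0 4 1 3 (by decide) (by decide) (by decide) (by decide) (by decide)
  have k10 := key 0 2 3 4 (by decide) (by decide) (by decide) (by decide) (by decide)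
  have k11 := key 0 3 2 4 (by decide) (by decide) (by decide) (by decide) (by decide)
  have k12 := key 0 4 2 3 (by decide) (by decide) (by decide) (by decide) (by decide)
  have k13 := key 1 2 3 4 (by decide) (by decide) (by decide) (by decide) (by decide)
  have k14 := key 1 3 2 4 (by decide) (by decide) (by decide) (by decide) (by decide)
  have k15 := key 1 4 2 3 (by decide) (by decide) (by decide) (by decide) (by decide)
  have a13 := hp 0 1 2 3 (by decide) (by decide) (by decide) (by decide) (by decide)
  have a14 := hp 0 1 2 4 (by decide) (by decide) (by decide) (by decide) (by decide)
  have a24 := hp 0 2 3 4 (by decide) (by decide) (by decide) (by decide) (by decide)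
  have a34 := hp 0 3 1 4 (by decide) (by decide) (by decide) (by decide) (by decide)
  -- Add the 15 relations modulo 2. Each `N` of a vertex and an edge occurs twice, and each `E` of a
  -- pair of points six times, counting both orders. What is left are the constants `-1` from
  -- reversing `E`: three for every four vertices, so 15, an odd number.
  omega

/-- The complete bipartite graph on three and three vertices cannot be mapped to the plane so that
independent edges have disjoint images. -/
theorem no_K33 (p q : Fin 3 → ℂ) (S : Fin 3 → Fin 3 → Set ℂ)
    (hS : ∀ i j, JoinedIn (S i j) (p i) (q j))
    (hd : ∀ i j k l, i ≠ k → j ≠ l → Disjoint (S i j) (S k l)) : False := by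
  obtain ⟨N, E, hE, hR⟩ := exists_curve_relations
  choose g c e0 e1 hm using fun i j => JoinedIn.exists_curve (hS i j)
  have key : ∀ i j k l, i ≠ k → j ≠ l →
      E (p i) (q l) - E (p i) (p k) + E (q l) (q j) - E (p k) (q j)
        + N (p i) (g k l) + N (q l) (g i j) - N (p k) (g i j) - N (q j) (g k l) = 0 := by
    intro i j k l h1 h2
    have := hR _ _ (c i j) (c k l) fun s r h =>
      Set.disjoint_left.1 (hd i j k l h1 h2) (hm i j s) (h ▸ hm k l r)
    rwa [e0, e1, e0, e1] at this
  have hq : ∀ j l, j ≠ l → E (q l) (q j) = - E (q j) (q l) - 1 := by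
    intro j l h
    refine hE _ _ fun he => Set.disjoint_left.1 (hd 0 j 1 l (by decide) h) (hm 0 j 1) ?_
    rw [e1, he, ← e1 1 l]; exact hm 1 l 1
  have k0011 := key 0 0 1 1 (by decide) (by decide)
  have k0012 := key 0 0 1 2 (by decide) (by decide)
  have k0110 := key 0 1 1 0 (by decide) (by decide)
  have k0112 := key 0 1 1 2 (by decide) (by decide)
  have k0210 := key 0 2 1 0 (by decide) (by decide)
  have k0211 := key 0 2 1 1 (by decide) (by decide)
  have k0021 := key 0 0 2 1 (by decide) (by decide)
  have k0022 := key 0 0 2 2 (by decide) (by decide)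
  have k0120 := key 0 1 2 0 (by decide) (by decide)
  have k0122 := key 0 1 2 2 (by decide) (by decide)
  have k0220 := key 0 2 2 0 (by decide) (by decide)
  have k0221 := key 0 2 2 1 (by decide) (by decide)
  have k1021 := key 1 0 2 1 (by decide) (by decide)
  have k1022 := key 1 0 2 2 (by decide) (by decide)
  have k1120 := key 1 1 2 0 (by decide) (by decide)
  have k1122 := key 1 1 2 2 (by decide) (by decide)
  have k1220 := key 1 2 2 0 (by decide) (by decide)
  have k1221 := key 1 2 2 1 (by decide) (by decide)
  have h01 := hq 0 1 (by decide)
  have h02 := hq 0 2 (by decide)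
  have h12 := hq 1 2 (by decide)
  -- In the sum of the 18 relations modulo 2, each `N` and each `E` involving some `p` occurs an
  -- even number of times. The `E` of two points `q` occur in both orders and leave `-1` for each of
  -- the three pairs of `p` and three pairs of `q`: nine times, an odd number.
  omega

end PlaneCurves

/-! ### From plane drawings to connected vertex sets -/

namespace ColoredPath

/-- `x` and `y` are joined by a walk inside the vertex set `S`. -/
def Conn {V : Type*} (G : SimpleGraph V) (S : Set V) (x y : V) : Prop :=
  ∃ W : G.Walk x y, ∀ w ∈ W.support, w ∈ S

namespace Conn

variable {V : Type*} {G : SimpleGraph V} {S S' : Set V} {x y z : V}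

theorem refl (h : x ∈ S) : Conn G S x x := ⟨.nil, by simpa using h⟩

theorem symm : Conn G S x y → Conn G S y x := fun ⟨W, h⟩ => ⟨W.reverse, by simpa using h⟩

theorem trans : Conn G S x y → Conn G S y z → Conn G S x z := fun ⟨W, h⟩ ⟨W', h'⟩ =>
  ⟨W.append W', fun w hw => by
    rcases SimpleGraph.Walk.mem_support_append_iff _ _ |>.1 hw with hw | hw
    exacts [h w hw, h' w hw]⟩

theorem mono (hS : S ⊆ S') : Conn G S x y → Conn G S' x y := fun ⟨W, h⟩ => ⟨W, fun w hw => hS (h w hw)⟩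

theorem left_mem : Conn G S x y → x ∈ S := fun ⟨W, h⟩ => h x W.start_mem_support

theorem right_mem : Conn G S x y → y ∈ S := fun ⟨W, h⟩ => h y W.end_mem_support

theorem of_adj (h : G.Adj x y) (hx : x ∈ S) (hy : y ∈ S) : Conn G S x y :=
  ⟨.cons h .nil, by simp [hx, hy]⟩

/-- Any two vertices of a chain are joined inside it. -/
theorem of_isChain {l : List V} (hl : l.IsChain G.Adj) (hx : x ∈ l) (hy : y ∈ l) :
    Conn G {w | w ∈ l} x y := by
  have hne : l ≠ [] := List.ne_nil_of_mem hx
  have head : ∀ z ∈ l, Conn G {w | w ∈ l} (l.head hne) z := by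
    intro z hz
    have hs := SimpleGraph.Walk.support_ofSupport hne hl
    classical
    refine ⟨(SimpleGraph.Walk.ofSupport l hne hl).takeUntil z (by rwa [hs]), fun w hw => ?_⟩
    have := SimpleGraph.Walk.support_takeUntil_subset_support _ _ hw
    rwa [hs] at this
  exact (head x hx).symm.trans (head y hy)

end Conn

namespace PlaneDrawing

variable {V : Type*} {G : SimpleGraph V} (D : PlaneDrawing G)

/-- The plane as the complex numbers. -/
noncomputable def toComplex (v : EuclideanSpace ℝ (Fin 2)) : ℂ := ⟨v 0, v 1⟩

theorem continuous_toComplex : Continuous toComplex := by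
  have : toComplex = fun v => (v 0 : ℂ) + (v 1 : ℂ) * Complex.I := by
    ext v; simp [toComplex, Complex.mk_eq_add_mul_I]
  rw [this]
  fun_prop

theorem toComplex_injective : Function.Injective toComplex := by
  intro v w h
  ext i
  have h0 := congrArg Complex.re h
  have h1 := congrArg Complex.im h
  fin_cases i
  exacts [h0, h1]

/-- The part of a drawing that belongs to the subgraph induced by `S`. -/
def region (S : Set V) : Set (EuclideanSpace ℝ (Fin 2)) :=
  D.pos '' S ∪ ⋃ (e : G.edgeSet) (_ : ∀ w ∈ e.1, w ∈ S), Set.range (D.arc e)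

theorem joinedIn_region_of_adj {S : Set V} {x y : V} (h : G.Adj x y) (hx : x ∈ S) (hy : y ∈ S) :
    JoinedIn (D.region S) (D.pos x) (D.pos y) := by
  let e : G.edgeSet := ⟨s(x, y), h⟩
  have hmem : ∀ r, D.arc e r ∈ D.region S := fun r => by
    refine Or.inr (Set.mem_iUnion₂.2 ⟨e, ?_, r, rfl⟩)
    intro w hw
    rcases Sym2.mem_iff.1 hw with rfl | rfl <;> assumption
  have hj : JoinedIn (D.region S) (D.arc e 0) (D.arc e 1) :=
    ⟨⟨⟨D.arc e, D.arc_continuous e⟩, rfl, rfl⟩, hmem⟩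
  have he : s(D.arc e 0, D.arc e 1) = s(D.pos x, D.pos y) := D.arc_ends e
  rcases Sym2.eq_iff.1 he with ⟨h0, h1⟩ | ⟨h0, h1⟩
  · rwa [h0, h1] at hj
  · rw [h0, h1] at hj; exact hj.symm

theorem joinedIn_region {S : Set V} {x y : V} (h : Conn G S x y) :
    JoinedIn (D.region S) (D.pos x) (D.pos y) := by
  obtain ⟨W, hW⟩ := h
  induction W with
  | nil => exact .refl (Or.inl ⟨_, hW _ (by simp), rfl⟩)
  | cons h W ih =>
    simp only [SimpleGraph.Walk.support_cons, List.mem_cons, forall_eq_or_imp] at hW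
    exact (D.joinedIn_region_of_adj h hW.1 (hW.2 _ W.start_mem_support)).trans (ih hW.2)

/-- Arcs contain no vertices but their ends and meet other arcs only in vertices. So a common point
would yield a vertex in both sets. -/
theorem disjoint_region {S S' : Set V} (h : Disjoint S S') :
    Disjoint (D.region S) (D.region S') := by
  have h' := Set.disjoint_left.1 h
  have hpos : ∀ {T : Set V} {w : V} {e : G.edgeSet}, (∀ w ∈ e.1, w ∈ T) →
      D.pos w ∈ Set.range (D.arc e) → w ∈ T := fun he hw => he _ (D.arc_vertex _ _ hw)
  refine Set.disjoint_left.2 ?_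
  rintro _ (⟨x, hx, rfl⟩ | hz) (⟨y, hy, hxy⟩ | hz')
  · exact h' hx (D.pos_injective hxy ▸ hy)
  · obtain ⟨e, he, hz'⟩ := Set.mem_iUnion₂.1 hz'
    exact h' hx (hpos he hz')
  · obtain ⟨e, he, hz⟩ := Set.mem_iUnion₂.1 hz
    exact h' (hpos he (hxy ▸ hz)) hy
  · obtain ⟨e, he, hz⟩ := Set.mem_iUnion₂.1 hz
    obtain ⟨f, hf, hz'⟩ := Set.mem_iUnion₂.1 hz'
    by_cases hef : e = f
    · subst hef
      obtain ⟨a, ha⟩ : ∃ a, a ∈ e.1 := ⟨_, Sym2.out_fst_mem _⟩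
      exact h' (he _ ha) (hf _ ha)
    · obtain ⟨w, rfl⟩ := D.arc_inter e f hef ⟨hz, hz'⟩
      exact h' (hpos he hz) (hpos hf hz')

theorem joinedIn_toComplex {S : Set V} {x y : V} (h : Conn G S x y) :
    JoinedIn (toComplex '' D.region S) (toComplex (D.pos x)) (toComplex (D.pos y)) := by
  have hj := D.joinedIn_region h
  exact ⟨hj.somePath.map continuous_toComplex, fun t => ⟨_, hj.somePath_mem t, rfl⟩⟩

theorem disjoint_toComplex {S S' : Set V} (h : Disjoint S S') :
    Disjoint (toComplex '' D.region S) (toComplex '' D.region S') :=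
  (Set.disjoint_image_iff toComplex_injective).2 (D.disjoint_region h)

end PlaneDrawing

/-- The inequalities in `hd` say that the two edges are independent. Sets of edges with a common end
may overlap arbitrarily, so no subdivision or minor has to be extracted. -/
theorem Planar.no_K5 {V : Type*} {G : SimpleGraph V} (hG : Planar G) (p : Fin 5 → V)
    (S : Fin 5 → Fin 5 → Set V) (hS : ∀ i j, i < j → Conn G (S i j) (p i) (p j))
    (hd : ∀ i j k l, i < j → k < l → i < k → j ≠ k → j ≠ l → Disjoint (S i j) (S k l)) :
    False := by
  obtain ⟨D⟩ := hG
  exact PlaneCurves.no_K5 _ _ (fun i j h => D.joinedIn_toComplex (hS i j h))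
    fun i j k l h1 h2 h3 h5 h6 => D.disjoint_toComplex (hd i j k l h1 h2 h3 h5 h6)

theorem Planar.no_K33 {V : Type*} {G : SimpleGraph V} (hG : Planar G) (p q : Fin 3 → V)
    (S : Fin 3 → Fin 3 → Set V) (hS : ∀ i j, Conn G (S i j) (p i) (q j))
    (hd : ∀ i j k l, i ≠ k → j ≠ l → Disjoint (S i j) (S k l)) : False := by
  obtain ⟨D⟩ := hG
  exact PlaneCurves.no_K33 _ _ _ (fun i j => D.joinedIn_toComplex (hS i j))
    fun i j k l h1 h2 => D.disjoint_toComplex (hd i j k l h1 h2)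

end ColoredPath

/-! ### The combinatorial core: six segments with bypasses -/

namespace ColoredPath

/-- The Ramsey number `R(3, 3)` is at most six. -/
theorem exists_triangle_or_independent (r : Fin 6 → Fin 6 → Prop) :
    ∃ i j l, i ≠ j ∧ i ≠ l ∧ j ≠ l ∧
      (r i j ∧ r i l ∧ r j l ∨ ¬ r i j ∧ ¬ r i l ∧ ¬ r j l) := by
  classical
  -- Three of the five values `r 0 ·` agree. As `r` need not be symmetric, `0` is put first in every
  -- triple that contains it.
  have h2 : ∀ (q : Fin 6 → Prop), (∃ i j l : Fin 6, i ≠ 0 ∧ j ≠ 0 ∧ l ≠ 0 ∧ i ≠ j ∧ i ≠ l ∧ j ≠ l ∧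
      (q i ∧ q j ∧ q l ∨ ¬ q i ∧ ¬ q j ∧ ¬ q l)) := by
    intro q
    have : (5 : ℕ) = ((Finset.univ.erase 0).filter q).card
        + ((Finset.univ.erase 0).filter fun i : Fin 6 => ¬ q i).card := by
      rw [Finset.card_filter_add_card_filter_not]; rfl
    obtain h | h : 2 < ((Finset.univ.erase 0).filter q).card ∨
        2 < ((Finset.univ.erase 0).filter fun i : Fin 6 => ¬ q i).card := by omega
    · obtain ⟨i, j, l, hi, hj, hl, h1, h2, h3⟩ := Finset.two_lt_card_iff.1 h
      simp only [Finset.mem_filter, Finset.mem_erase] at hi hj hl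
      exact ⟨i, j, l, hi.1.1, hj.1.1, hl.1.1, h1, h2, h3, Or.inl ⟨hi.2, hj.2, hl.2⟩⟩
    · obtain ⟨i, j, l, hi, hj, hl, h1, h2, h3⟩ := Finset.two_lt_card_iff.1 h
      simp only [Finset.mem_filter, Finset.mem_erase] at hi hj hl
      exact ⟨i, j, l, hi.1.1, hj.1.1, hl.1.1, h1, h2, h3, Or.inr ⟨hi.2, hj.2, hl.2⟩⟩
  obtain ⟨i, j, l, hi, hj, hl, hij, hil, hjl, h | h⟩ := h2 (r 0)
  · by_cases h1 : r i j
    · exact ⟨0, i, j, hi.symm, hj.symm, hij, Or.inl ⟨h.1, h.2.1, h1⟩⟩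
    by_cases h2 : r i l
    · exact ⟨0, i, l, hi.symm, hl.symm, hil, Or.inl ⟨h.1, h.2.2, h2⟩⟩
    by_cases h3 : r j l
    · exact ⟨0, j, l, hj.symm, hl.symm, hjl, Or.inl ⟨h.2.1, h.2.2, h3⟩⟩
    exact ⟨i, j, l, hij, hil, hjl, Or.inr ⟨h1, h2, h3⟩⟩
  · by_cases h1 : r i j
    · by_cases h2 : r i l
      · by_cases h3 : r j l
        · exact ⟨i, j, l, hij, hil, hjl, Or.inl ⟨h1, h2, h3⟩⟩
        exact ⟨0, j, l, hj.symm, hl.symm, hjl, Or.inr ⟨h.2.1, h.2.2, h3⟩⟩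
      exact ⟨0, i, l, hi.symm, hl.symm, hil, Or.inr ⟨h.1, h.2.2, h2⟩⟩
    exact ⟨0, i, j, hi.symm, hj.symm, hij, Or.inr ⟨h.1, h.2.1, h1⟩⟩

/-- A digraph with small outdegrees has a large independent set. -/
theorem exists_independent {ι : Type*} [DecidableEq ι] (hit : ι → ι → Prop) (d : ℕ) (r : ℕ) :
    ∀ J : Finset ι, (∀ i ∈ J, ∀ A ⊆ J, (∀ j ∈ A, j ≠ i ∧ hit i j) → A.card ≤ d) →
      r * (2 * d + 1) < J.card →
      ∃ A ⊆ J, A.card = r + 1 ∧ ∀ i ∈ A, ∀ j ∈ A, i ≠ j → ¬ hit i j := by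
  classical
  induction r with
  | zero =>
    intro J _ hJ
    obtain ⟨i, hi⟩ : J.Nonempty := Finset.card_pos.1 (by omega)
    exact ⟨{i}, by simpa, by simp, by simp⟩
  | succ r ih =>
    intro J hd hJ
    let out : ι → Finset ι := fun i => J.filter fun j => j ≠ i ∧ hit i j
    let inn : ι → Finset ι := fun j => J.filter fun i => j ≠ i ∧ hit i j
    have hout : ∀ i ∈ J, (out i).card ≤ d := fun i hi =>
      hd i hi _ (Finset.filter_subset _ _) fun j hj => (Finset.mem_filter.1 hj).2
    have hne : J.Nonempty := Finset.card_pos.1 (by omega)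
    -- Indegrees and outdegrees have the same sum, so some vertex has indegree at most `d`. It is
    -- kept, and its at most `2 * d` neighbours are discarded.
    obtain ⟨i, hi, hin⟩ : ∃ i ∈ J, (inn i).card ≤ d := by
      by_contra! hcon
      have h1 : ∑ i ∈ J, (inn i).card = ∑ i ∈ J, (out i).card :=
        (Finset.sum_card_bipartiteAbove_eq_sum_card_bipartiteBelow (s := J) (t := J)
          (fun i j => j ≠ i ∧ hit i j)).symm
      have h2 : ∑ i ∈ J, (out i).card ≤ J.card * d := by
        simpa using Finset.sum_le_card_nsmul J _ d hout
      have h3 : J.card * (d + 1) ≤ ∑ i ∈ J, (inn i).card := by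
        simpa using Finset.card_nsmul_le_sum J _ (d + 1) hcon
      have := hne.card_pos
      nlinarith
    let J' := J \ (insert i (out i ∪ inn i))
    have hJ' : r * (2 * d + 1) < J'.card := by
      change _ < (J \ (insert i (out i ∪ inn i))).card
      have h1 := Finset.le_card_sdiff (insert i (out i ∪ inn i)) J
      have h2 := Finset.card_insert_le i (out i ∪ inn i)
      have h3 := Finset.card_union_le (out i) (inn i)
      have h4 := hout i hi
      have : (r + 1) * (2 * d + 1) = r * (2 * d + 1) + (2 * d + 1) := by ring
      omega
    obtain ⟨A, hA, hcard, hind⟩ := ih J' (fun j hj B hB => hd j (Finset.sdiff_subset hj) B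
      (hB.trans Finset.sdiff_subset)) hJ'
    have hiA : i ∉ A := fun h => by simpa [J'] using hA h
    have hAJ : ∀ j ∈ A, j ≠ i → ¬ hit i j ∧ ¬ hit j i := by
      intro j hj hji
      have := hA hj
      simp only [J', out, inn, Finset.mem_sdiff, Finset.mem_insert, Finset.mem_union,
        Finset.mem_filter] at this
      have hij := hji.symm
      tauto
    refine ⟨insert i A, Finset.insert_subset hi (hA.trans Finset.sdiff_subset),
      by rw [Finset.card_insert_of_notMem hiA, hcard], ?_⟩
    intro a ha b hb hab
    rcases Finset.mem_insert.1 ha with rfl | ha' <;> rcases Finset.mem_insert.1 hb with rfl | hb'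
    · exact absurd rfl hab
    · exact (hAJ b hb' hab.symm).1
    · exact (hAJ a ha' hab).2
    · exact hind a ha' b hb' hab

section Core

variable {V : Type*} {G : SimpleGraph V} {ι : Type*} {u u' t : V} {R Γ T : ι → Set V} {x y z : ι → V}

/-- Three disjoint `u`-`u'` connections cannot all be reached from `t` without touching each other. -/
theorem Planar.not_three_disjoint (hG : Planar G) (huu : u ≠ u')
    (hux : ∀ i, G.Adj u (x i)) (hzu : ∀ i, G.Adj (z i) u')
    (hx : ∀ i, Conn G (R i) (x i) (y i)) (hz : ∀ i, Conn G (R i) (z i) (y i))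
    (hT : ∀ i, Conn G (T i) t (y i))
    (hR : ∀ i, u ∉ R i ∧ u' ∉ R i) (hT' : ∀ i, u ∉ T i ∧ u' ∉ T i)
    (hTR : ∀ i j, i ≠ j → Disjoint (T i) (R j)) (a : Fin 3 → ι) (ha : Function.Injective a)
    (hRR : ∀ i j, i ≠ j → Disjoint (R (a i)) (R (a j))) : False := by
  -- The edges at `y (a j)` run to `u` and `u'` through its own `R` and to `t` through `T`. The sets
  -- `T` may meet one another, as their edges share the end `t`.
  refine hG.no_K33 ![u, u', t] (fun j => y (a j))
    (fun i j => ![insert u (R (a j)), insert u' (R (a j)), T (a j)] i) ?_ ?_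
  · intro i j
    fin_cases i
    · exact (Conn.of_adj (hux _) (by simp) (by simp [(hx (a j)).left_mem])).trans
        ((hx _).mono (by simp))
    · exact (Conn.of_adj (hzu _).symm (by simp) (by simp [(hz (a j)).left_mem])).trans
        ((hz _).mono (by simp))
    · exact hT _
  · intro i j k l hik hjl
    have hjl' := ha.ne hjl
    have h1 := hRR j l hjl
    have h2 := hTR _ _ hjl'
    have h3 := (hTR _ _ hjl'.symm).symm
    have h4 := hR (a j)
    have h5 := hR (a l)
    have h6 := hT' (a j)
    have h7 := hT' (a l)
    fin_cases i <;> fin_cases k <;>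
      simp [Set.disjoint_insert_left, Set.disjoint_insert_right, *, huu.symm] at hik ⊢

/-- Three `u`-`u'` connections cannot meet pairwise when each can be bypassed without touching the
others, and a fourth bypass exists. -/
theorem Planar.not_three_meeting (hG : Planar G) (huu : u ≠ u')
    (hux : ∀ i, G.Adj u (x i)) (hzu : ∀ i, G.Adj (z i) u')
    (hxx : ∀ i, x i ∈ R i) (hx : ∀ i, ∀ w ∈ R i, Conn G (R i) (x i) w)
    (hΓ : ∀ i, Conn G (Γ i) (x i) (z i))
    (hR : ∀ i, u ∉ R i ∧ u' ∉ R i) (hΓ' : ∀ i, u ∉ Γ i ∧ u' ∉ Γ i)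
    (hΓR : ∀ i j, i ≠ j → Disjoint (Γ i) (R j)) {i j l m : ι}
    (hij : i ≠ j) (hil : i ≠ l) (hjl : j ≠ l) (hmi : m ≠ i) (hmj : m ≠ j) (hml : m ≠ l)
    (h1 : ¬ Disjoint (R i) (R j)) (h2 : ¬ Disjoint (R i) (R l)) (h3 : ¬ Disjoint (R j) (R l)) :
    False := by
  have hmeet : ∀ {a b}, ¬ Disjoint (R a) (R b) → Conn G (R a ∪ R b) (x a) (x b) := by
    intro a b h
    obtain ⟨w, ha, hb⟩ := Set.not_disjoint_iff.1 h
    exact ((hx a w ha).mono Set.subset_union_left).trans ((hx b w hb).symm.mono Set.subset_union_right)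
  have hxu : ∀ a, Conn G {u, x a} u (x a) := fun a => Conn.of_adj (hux a) (by simp) (by simp)
  have hxu' : ∀ a, Conn G (insert u' (Γ a)) u' (x a) := fun a =>
    (Conn.of_adj (hzu a).symm (by simp) (by simp [(hΓ a).right_mem])).trans
      ((hΓ a).symm.mono (by simp))
  have hxΓ : ∀ a, x a ∈ Γ a := fun a => (hΓ a).left_mem
  have hxR : ∀ a b, a ≠ b → x a ∉ R b := fun a b h hb => Set.disjoint_left.1 (hΓR a b h) (hxΓ a) hb
  have hR1 := fun a => (hR a).1
  have hR2 := fun a => (hR a).2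
  have hΓ1 := fun a => (hΓ' a).1
  have hΓ2 := fun a => (hΓ' a).2
  have hxΓ' : ∀ a b, a ≠ b → x a ∉ Γ b := fun a b h hb => Set.disjoint_left.1 (hΓR b a h.symm) hb (hxx a)
  have hux' : ∀ a, u ≠ x a := fun a => (hux a).ne
  have hxu'' : ∀ a, u' ≠ x a := fun a h => hΓ2 a (h ▸ hxΓ a)
  have e1 := hΓR i j hij
  have e2 := hΓR i l hil
  have e3 := hΓR j l hjl
  have e4 := hΓR j i hij.symm
  have e5 := hΓR l i hil.symm
  have e6 := hΓR l j hjl.symm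
  have e7 := hΓR m i hmi
  have e8 := hΓR m j hmj
  have e9 := hΓR m l hml
  -- The 15 pairs of independent edges of `K₅`.
  have hcases : ∀ a b c d : Fin 5, a < b → c < d → a < c → b ≠ c → b ≠ d →
      (a, b, c, d) ∈ [((0 : Fin 5), (1 : Fin 5), (2 : Fin 5), (3 : Fin 5)), (0, 1, 2, 4), (0, 1, 3, 4),
        (0, 2, 1, 3), (0, 2, 1, 4), (0, 2, 3, 4), (0, 3, 1, 2), (0, 3, 1, 4), (0, 3, 2, 4),
        (0, 4, 1, 2), (0, 4, 1, 3), (0, 4, 2, 3), (1, 2, 3, 4), (1, 3, 2, 4), (1, 4, 2, 3)] := by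
    decide
  -- Edges between two of the `x` pass through a meeting point of their `R`; edges at `u'` use the
  -- bypasses, and the edge from `u` to `u'` uses that of the fourth index `m`. The bypasses may
  -- meet one another, since all these edges share the end `u'`.
  refine hG.no_K5 ![u, u', x i, x j, x l]
    ![![∅, insert u (insert u' (Γ m)), {u, x i}, {u, x j}, {u, x l}],
      ![∅, ∅, insert u' (Γ i), insert u' (Γ j), insert u' (Γ l)],
      ![∅, ∅, ∅, R i ∪ R j, R i ∪ R l], ![∅, ∅, ∅, ∅, R j ∪ R l], fun _ => ∅] ?_ ?_
  · have huΓ : Conn G (insert u (insert u' (Γ m))) u u' :=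
      ((hxu m).mono (by simp [Set.insert_subset_iff, hxΓ])).trans
        ((hxu' m).symm.mono (by simp))
    intro a b hab
    fin_cases a <;> fin_cases b <;> first
      | exact absurd hab (by decide)
      | exact huΓ
      | exact hxu _
      | exact hxu' _
      | exact hmeet h1
      | exact hmeet h2
      | exact hmeet h3
  · intro a b c d g1 g2 g3 g4 g5
    have := hcases a b c d g1 g2 g3 g4 g5
    simp only [List.mem_cons, Prod.mk.injEq, List.not_mem_nil, or_false] at this
    rcases this with h | h | h | h | h | h | h | h | h | h | h | h | h | h | h <;>
    · obtain ⟨rfl, rfl, rfl, rfl⟩ := h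
      simp [Set.disjoint_insert_left, Set.disjoint_insert_right, hij, hij.symm, hil, hil.symm,
        hjl, hjl.symm, huu.symm, hR1, hR2, hΓ1, hxR, hxΓ', hxu'', e1, e2, e3,
        e4, e5, e6, e7, e8, e9]

/-- Six `u`-`u'` connections with bypasses, reached from `t`, none touched by the data of another. -/
theorem Planar.not_six (hG : Planar G) {R Γ T : Fin 6 → Set V} {x y z : Fin 6 → V} (huu : u ≠ u')
    (hux : ∀ i, G.Adj u (x i)) (hzu : ∀ i, G.Adj (z i) u')
    (hxx : ∀ i, x i ∈ R i) (hy : ∀ i, y i ∈ R i) (hz : ∀ i, z i ∈ R i)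
    (hx : ∀ i, ∀ w ∈ R i, Conn G (R i) (x i) w)
    (hΓ : ∀ i, Conn G (Γ i) (x i) (z i)) (hT : ∀ i, Conn G (T i) t (y i))
    (hR : ∀ i, u ∉ R i ∧ u' ∉ R i) (hΓ' : ∀ i, u ∉ Γ i ∧ u' ∉ Γ i) (hT' : ∀ i, u ∉ T i ∧ u' ∉ T i)
    (hΓR : ∀ i j, i ≠ j → Disjoint (Γ i) (R j)) (hTR : ∀ i j, i ≠ j → Disjoint (T i) (R j)) :
    False := by
  obtain ⟨i, j, l, hij, hil, hjl, ⟨h1, h2, h3⟩ | ⟨h1, h2, h3⟩⟩ :=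
    exists_triangle_or_independent fun i j => Disjoint (R i) (R j)
  · refine hG.not_three_disjoint huu hux hzu (fun i => hx i _ (hy i))
      (fun i => (hx i _ (hz i)).symm.trans (hx i _ (hy i))) hT hR hT' hTR ![i, j, l] ?_ ?_
    · intro a b
      fin_cases a <;> fin_cases b <;> simp [hij, hil, hjl, hij.symm, hil.symm, hjl.symm]
    · intro a b
      fin_cases a <;> fin_cases b <;> simp [h1, h2, h3, h1.symm, h2.symm, h3.symm]
  · obtain ⟨m, hm⟩ : ∃ m : Fin 6, m ∉ ({i, j, l} : Finset (Fin 6)) := by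
      by_contra! h
      have h1 : (Finset.univ : Finset (Fin 6)) ⊆ {i, j, l} := fun m _ => h m
      have h2 := Finset.card_le_card h1
      have h3 : ({i, j, l} : Finset (Fin 6)).card ≤ 3 := Finset.card_le_three
      simp at h2
      omega
    simp only [Finset.mem_insert, Finset.mem_singleton, not_or] at hm
    exact hG.not_three_meeting huu hux hzu hxx hx hΓ hR hΓ' hΓR hij hil hjl hm.1 hm.2.1 hm.2.2 h1 h2 h3

end Core
end ColoredPath

/-! ### Colours along walks and the search from `t` -/

namespace ColoredPath

section Colors

variable {V C : Type*} {G : SimpleGraph V} {χ : V → Finset C}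

theorem mem_walkColors [DecidableEq V] [DecidableEq C] {x y : V} {W : G.Walk x y} {c : C} :
    c ∈ walkColors χ W ↔ ∃ w ∈ W.support, c ∈ χ w := by
  simp [walkColors]

theorem ColorConnected.conn (h : ColorConnected G χ) {c : C} {x y : V} (hx : c ∈ χ x)
    (hy : c ∈ χ y) : Conn G {w | c ∈ χ w} x y := by
  have key : ∀ {a b : {w | c ∈ χ w}}, (G.induce {w | c ∈ χ w}).Walk a b → Conn G {w | c ∈ χ w} a b := by
    intro a b W
    induction W with
    | nil => exact Conn.refl (Subtype.prop _)
    | @cons u v _ h W ih =>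
      have h' : G.Adj u v := h
      exact (Conn.of_adj h' u.2 v.2).trans ih
  obtain ⟨W⟩ := h c ⟨x, hx⟩ ⟨y, hy⟩
  exact key W

/-- A walk can be cut after the last vertex with a given property. -/
theorem exists_last_mem {p : V → Prop} {x y : V} (W : G.Walk x y) (hx : ∃ b ∈ W.support, p b) :
    ∃ a ∈ W.support, p a ∧ (a = y ∨ ∃ a', G.Adj a a' ∧ ∃ W' : G.Walk a' y,
      (∀ w ∈ W'.support, w ∈ W.support ∧ ¬ p w)) := by
  induction W with
  | nil =>
    obtain ⟨b, hb, hpb⟩ := hx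
    exact ⟨b, hb, hpb, Or.inl (by simpa using hb)⟩
  | @cons u w y h W ih =>
    by_cases hex : ∃ b ∈ W.support, p b
    · obtain ⟨a, ha, hpa, h'⟩ := ih hex
      refine ⟨a, by simp [ha], hpa, h'.imp_right ?_⟩
      rintro ⟨a', h1, W', h2⟩
      exact ⟨a', h1, W', fun w hw => ⟨by simp [(h2 w hw).1], (h2 w hw).2⟩⟩
    · obtain ⟨b, hb, hpb⟩ := hx
      rcases List.mem_cons.1 (by simpa using hb) with rfl | hb
      · exact ⟨b, by simp, hpb, Or.inr ⟨w, h, W, fun w' hw' =>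
          ⟨by simp [hw'], fun hp => hex ⟨w', hw', hp⟩⟩⟩⟩
      · exact absurd ⟨b, hb, hpb⟩ hex

/-- After the last vertex of a colour, a walk ends or continues, with that colour gone, from a coloured
vertex that is adjacent or two steps away across an uncoloured vertex. -/
theorem exists_last_color [DecidableEq V] [DecidableEq C] (hχ : ColorIrreducible G χ) {x y : V}
    (W : G.Walk x y) (hy : χ y ≠ ∅) {c : C} (hx : c ∈ χ x) :
    ∃ a ∈ W.support, c ∈ χ a ∧ (a = y ∨ ∃ e b, G.Adj a e ∧ χ b ≠ ∅ ∧
      (e = b ∨ e ∈ W.support ∧ χ e = ∅ ∧ G.Adj e b) ∧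
      ∃ W' : G.Walk b y, W'.support ⊆ W.support ∧
        (walkColors χ W').card < (walkColors χ W).card) := by
  obtain ⟨a, ha, hca, h⟩ := exists_last_mem (p := fun w => c ∈ χ w) W ⟨x, by simp, hx⟩
  refine ⟨a, ha, hca, h.imp_right ?_⟩
  rintro ⟨e, hae, W', hW'⟩
  have hlt : ∀ {b : V} (W'' : G.Walk b y), W''.support ⊆ W'.support →
      W''.support ⊆ W.support ∧ (walkColors χ W'').card < (walkColors χ W).card := by
    intro b W'' hs
    refine ⟨fun w hw => (hW' w (hs hw)).1, Finset.card_lt_card ?_⟩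
    refine Finset.ssubset_iff_of_subset (fun d hd => ?_) |>.2
      ⟨c, mem_walkColors.2 ⟨x, by simp, hx⟩, fun hc => ?_⟩
    · obtain ⟨w, hw, hd⟩ := mem_walkColors.1 hd
      exact mem_walkColors.2 ⟨w, (hW' w (hs hw)).1, hd⟩
    · obtain ⟨w, hw, hd⟩ := mem_walkColors.1 hc
      exact (hW' w (hs hw)).2 hd
  -- An uncoloured `e` is not the end of the walk, and its successor is coloured: two adjacent
  -- uncoloured vertices would have the same colour set.
  by_cases he : χ e = ∅
  · cases W' with
    | nil => exact absurd he hy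
    | @cons _ b _ h W'' =>
      exact ⟨e, b, hae, fun hb => hχ e b h (he.trans hb.symm),
        Or.inr ⟨(hW' e (by simp)).1, he, h⟩, W'', hlt W'' (by simp)⟩
  · exact ⟨e, e, hae, he, Or.inl rfl, W', hlt W' (List.Subset.refl _)⟩

/-- A walk between coloured vertices with at most `r + 1` colours can be replaced by one inside the
union of its colours and at most `r` of its other vertices. -/
theorem exists_skeleton [DecidableEq V] [DecidableEq C] (hχ : ColorIrreducible G χ)
    (hc : ColorConnected G χ) (r : ℕ) : ∀ {x y : V} (W : G.Walk x y), χ x ≠ ∅ → χ y ≠ ∅ →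
      (walkColors χ W).card ≤ r + 1 → ∃ E : Finset V, (∀ e ∈ E, e ∈ W.support) ∧ E.card ≤ r ∧
        Conn G {w | w ∈ E ∨ ∃ c ∈ walkColors χ W, c ∈ χ w} x y := by
  induction r with
  | zero =>
    intro x y W hx hy hW
    obtain ⟨c, hcx⟩ := Finset.nonempty_iff_ne_empty.2 hx
    obtain ⟨c', hcy⟩ := Finset.nonempty_iff_ne_empty.2 hy
    have hcW : c ∈ walkColors χ W := mem_walkColors.2 ⟨x, by simp, hcx⟩
    have hcc' : c' = c := Finset.card_le_one.1 hW c' (mem_walkColors.2 ⟨y, by simp, hcy⟩) c hcW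
    subst hcc'
    exact ⟨∅, by simp, by simp, (hc.conn hcx hcy).mono fun w hw => Or.inr ⟨c', hcW, hw⟩⟩
  | succ r ih =>
    intro x y W hx hy hW
    obtain ⟨c, hcx⟩ := Finset.nonempty_iff_ne_empty.2 hx
    have hcW : c ∈ walkColors χ W := mem_walkColors.2 ⟨x, by simp, hcx⟩
    -- Inside the class of `c` one reaches the last vertex `a` of that colour. Continuing from there
    -- costs at most one further vertex `e` and leaves a walk with fewer colours.
    obtain ⟨a, ha, hca, rfl | ⟨e, b, hae, hb, he, W', hs, hlt⟩⟩ := exists_last_color hχ W hy hcx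
    · exact ⟨∅, by simp, by simp, (hc.conn hcx hca).mono fun w hw => Or.inr ⟨c, hcW, hw⟩⟩
    · obtain ⟨E, hE, hcard, hconn⟩ := ih W' hb hy (by omega)
      have hsub : walkColors χ W' ⊆ walkColors χ W := fun d hd => by
        obtain ⟨w, hw, hd⟩ := mem_walkColors.1 hd
        exact mem_walkColors.2 ⟨w, hs hw, hd⟩
      have hbW : ∃ c ∈ walkColors χ W, c ∈ χ b := by
        obtain ⟨c', hc'⟩ := Finset.nonempty_iff_ne_empty.2 hb
        exact ⟨c', mem_walkColors.2 ⟨b, hs (by simp), hc'⟩, hc'⟩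
      rcases he with rfl | ⟨heW, -, heb⟩
      · refine ⟨E, fun e he => hs (hE e he), by omega, ?_⟩
        refine ((hc.conn hcx hca).mono fun w hw => Or.inr ⟨c, hcW, hw⟩).trans
          ((Conn.of_adj hae (Or.inr ⟨c, hcW, hca⟩) (Or.inr hbW)).trans (hconn.mono ?_))
        rintro w (hw | ⟨d, hd, hdw⟩)
        exacts [Or.inl hw, Or.inr ⟨d, hsub hd, hdw⟩]
      · refine ⟨insert e E, ?_, (Finset.card_insert_le _ _).trans (by omega), ?_⟩
        · intro f hf
          rcases Finset.mem_insert.1 hf with rfl | hf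
          exacts [heW, hs (hE f hf)]
        · refine ((hc.conn hcx hca).mono fun w hw => Or.inr ⟨c, hcW, hw⟩).trans
            ((Conn.of_adj hae (Or.inr ⟨c, hcW, hca⟩) (Or.inl (by simp))).trans
              ((Conn.of_adj heb (Or.inl (by simp)) (Or.inr hbW)).trans (hconn.mono ?_)))
          rintro w (hw | ⟨d, hd, hdw⟩)
          exacts [Or.inl (by simp [hw]), Or.inr ⟨d, hsub hd, hdw⟩]

/-- The vertices found from `t` in `j` rounds: a round passes from found vertices to the colours on them
and their neighbours, and from these colours to the vertices carrying them and to the uncoloured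
vertices next to those. Vertices outside `A` are avoided. -/
def front (G : SimpleGraph V) (χ : V → Finset C) (A : V → Prop) (t : V) : ℕ → V → Prop
  | 0, y => y = t
  | j + 1, y => front G χ A t j y ∨ ∃ c w,
      (∃ a b, front G χ A t j a ∧ (a = b ∨ G.Adj a b) ∧ c ∈ χ b) ∧ c ∈ χ w ∧
        (w = y ∨ G.Adj w y ∧ χ y = ∅ ∧ A y)

/-- The colours found from `t` in the first half of round `j + 1`. -/
def marked (G : SimpleGraph V) (χ : V → Finset C) (A : V → Prop) (t : V) (j : ℕ) (c : C) : Prop :=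
  ∃ a b, front G χ A t j a ∧ (a = b ∨ G.Adj a b) ∧ c ∈ χ b

variable {A : V → Prop} {t : V}

theorem front_succ_iff {j : ℕ} {y : V} : front G χ A t (j + 1) y ↔ front G χ A t j y ∨
    ∃ c w, marked G χ A t j c ∧ c ∈ χ w ∧ (w = y ∨ G.Adj w y ∧ χ y = ∅ ∧ A y) := Iff.rfl

theorem marked_mono {i j : ℕ} (h : i ≤ j) {c : C} : marked G χ A t i c → marked G χ A t j c := by
  have hf : ∀ y, front G χ A t i y → front G χ A t j y := by
    induction h with
    | refl => exact fun _ h => h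
    | step _ ih => exact fun y hy => Or.inl (ih y hy)
  rintro ⟨a, b, ha, h⟩
  exact ⟨a, b, hf a ha, h⟩

/-- One round reaches the last vertex of a marked colour and, across at most one uncoloured vertex,
the next coloured one. What remains of the walk has fewer colours, so the number of colours bounds
the number of rounds. -/
theorem marked_of_walk [DecidableEq V] [DecidableEq C] (hχ : ColorIrreducible G χ) (r : ℕ) :
    ∀ {x y : V} (W : G.Walk x y) (j : ℕ), χ x ≠ ∅ → (∀ c ∈ χ x, marked G χ A t j c) →
      (∀ w ∈ W.support, A w) → (walkColors χ W).card ≤ r + 1 →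
      ∀ c ∈ χ y, marked G χ A t (j + r) c := by
  induction r with
  | zero =>
    intro x y W j hx hm hA hW c hc
    obtain ⟨c', hc'⟩ := Finset.nonempty_iff_ne_empty.2 hx
    have : c = c' := Finset.card_le_one.1 hW c (mem_walkColors.2 ⟨y, by simp, hc⟩) c'
      (mem_walkColors.2 ⟨x, by simp, hc'⟩)
    exact hm c (this ▸ hc')
  | succ r ih =>
    intro x y W j hx hm hA hW d hd
    obtain ⟨c, hc⟩ := Finset.nonempty_iff_ne_empty.2 hx
    have hy : χ y ≠ ∅ := Finset.ne_empty_of_mem hd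
    obtain ⟨a, ha, hca, hcase⟩ := exists_last_color hχ W hy hc
    have hfa : front G χ A t (j + 1) a :=
      front_succ_iff.2 (Or.inr ⟨c, a, hm c hc, hca, Or.inl rfl⟩)
    rcases hcase with rfl | ⟨e, b, hae, hb, he, W', hs, hlt⟩
    · exact marked_mono (by omega) ⟨a, a, hfa, Or.inl rfl, hd⟩
    · have hmb : ∀ c ∈ χ b, marked G χ A t (j + 1) c := by
        intro c' hc'
        rcases he with rfl | ⟨heW, he, heb⟩
        · exact ⟨a, e, hfa, Or.inr hae, hc'⟩
        · exact ⟨e, b, front_succ_iff.2 (Or.inr ⟨c, a, hm c hc, hca, Or.inr ⟨hae, he, hA e heW⟩⟩),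
            Or.inr heb, hc'⟩
      have := ih W' (j + 1) hb hmb (fun w hw => hA w (hs hw)) (by omega) d hd
      rwa [add_right_comm, add_assoc] at this

/-- All colours on a walk from `t` with at most `k` colours are marked. -/
theorem marked_of_walk_start [DecidableEq V] [DecidableEq C] (hχ : ColorIrreducible G χ) {k : ℕ} {y : V}
    (W : G.Walk t y) (hA : ∀ w ∈ W.support, A w) (hW : (walkColors χ W).card ≤ k) {c : C}
    (hc : c ∈ χ y) : marked G χ A t (k - 1) c := by
  -- If `t` is uncoloured, its successor on the walk is coloured, and its colours are marked at
  -- index `0`; no round is lost.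
  by_cases ht : χ t = ∅
  · cases W with
    | nil => simp [ht] at hc
    | @cons _ b _ h W' =>
      have hW' : (walkColors χ W').card ≤ k := (Finset.card_le_card fun d hd => by
        obtain ⟨w, hw, hd⟩ := mem_walkColors.1 hd
        exact mem_walkColors.2 ⟨w, by simp [hw], hd⟩).trans hW
      have := marked_of_walk (A := A) (t := t) hχ (k - 1) W' 0 (fun hb => hχ t b h (ht.trans hb.symm))
        (fun c hc => ⟨t, b, rfl, Or.inr h, hc⟩) (fun w hw => hA w (by simp [hw])) (by omega) c hc
      rwa [zero_add] at this
  · have := marked_of_walk (A := A) (t := t) hχ (k - 1) W 0 ht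
      (fun c hc => ⟨t, t, rfl, Or.inl rfl, hc⟩) hA (by omega) c hc
    rwa [zero_add] at this

/-- A found vertex is joined to `t` inside few colours and few other vertices. -/
theorem exists_conn_of_front [DecidableEq V] [DecidableEq C] (hc : ColorConnected G χ) (ht : A t) (j : ℕ) :
    ∀ y, front G χ A t j y → ∃ (K : Finset C) (E : Finset V), K.card ≤ j ∧ E.card ≤ j + 1 ∧
      (∀ e ∈ E, A e) ∧ Conn G {w | w ∈ E ∨ ∃ c ∈ K, c ∈ χ w} t y := by
  induction j with
  | zero =>
    rintro y rfl
    exact ⟨∅, {y}, by simp, by simp, by simpa using ht, Conn.refl (by simp)⟩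
  | succ j ih =>
    rintro y (hy | ⟨c, w, ⟨a, b, ha, hab, hcb⟩, hcw, hwy⟩)
    · obtain ⟨K, E, hK, hE, h⟩ := ih y hy
      exact ⟨K, E, by omega, by omega, h⟩
    · obtain ⟨K, E, hK, hE, hEA, h⟩ := ih a ha
      let S : Set V := {w | w ∈ E ∨ ∃ d ∈ insert c K, d ∈ χ w}
      have hcS : ∀ {w}, c ∈ χ w → w ∈ S := fun hw => Or.inr ⟨c, by simp, hw⟩
      have h1 : Conn G S t a := h.mono (by
        rintro w (hw | ⟨d, hd, hdw⟩)
        exacts [Or.inl hw, Or.inr ⟨d, by simp [hd], hdw⟩])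
      have h2 : Conn G S a b := by
        rcases hab with rfl | hab
        exacts [Conn.refl (hcS hcb), Conn.of_adj hab h1.right_mem (hcS hcb)]
      have h3 : Conn G S t w := h1.trans (h2.trans ((hc.conn hcb hcw).mono fun w hw => hcS hw))
      have hK' : (insert c K).card ≤ j + 1 := (Finset.card_insert_le _ _).trans (by omega)
      rcases hwy with rfl | ⟨hwy, -, hAy⟩
      · exact ⟨insert c K, E, hK', by omega, hEA, h3⟩
      · refine ⟨insert c K, insert y E, hK', (Finset.card_insert_le _ _).trans (by omega), ?_, ?_⟩
        · simpa using ⟨hAy, hEA⟩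
        · have hS : S ⊆ {w | w ∈ insert y E ∨ ∃ d ∈ insert c K, d ∈ χ w} := by
            rintro w (hw | hw)
            exacts [Or.inl (by simp [hw]), Or.inr hw]
          exact (h3.mono hS).trans (Conn.of_adj hwy (hS (hcS hcw)) (by simp))

/-- The last half round adds the colour `c` and no vertex. For `j = k - 1` with `k ≥ 1` both bounds
become `k`. -/
theorem exists_conn_of_marked [DecidableEq V] [DecidableEq C] (hc : ColorConnected G χ) (ht : A t) {j : ℕ}
    {c : C} (hm : marked G χ A t j c) {y : V} (hy : c ∈ χ y) :
    ∃ (K : Finset C) (E : Finset V), K.card ≤ j + 1 ∧ E.card ≤ j + 1 ∧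
      (∀ e ∈ E, A e) ∧ Conn G {w | w ∈ E ∨ ∃ c ∈ K, c ∈ χ w} t y := by
  obtain ⟨a, b, ha, hab, hcb⟩ := hm
  obtain ⟨K, E, hK, hE, hEA, h⟩ := exists_conn_of_front hc ht j a ha
  let S : Set V := {w | w ∈ E ∨ ∃ d ∈ insert c K, d ∈ χ w}
  have hcS : ∀ {w}, c ∈ χ w → w ∈ S := fun hw => Or.inr ⟨c, by simp, hw⟩
  have h1 : Conn G S t a := h.mono (by
    rintro w (hw | ⟨d, hd, hdw⟩)
    exacts [Or.inl hw, Or.inr ⟨d, by simp [hd], hdw⟩])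
  have h2 : Conn G S a b := by
    rcases hab with rfl | hab
    exacts [Conn.refl (hcS hcb), Conn.of_adj hab h1.right_mem (hcS hcb)]
  exact ⟨insert c K, E, (Finset.card_insert_le _ _).trans (by omega), hE, hEA,
    h1.trans (h2.trans ((hc.conn hcb hy).mono fun w hw => hcS hw))⟩

end Colors
end ColoredPath

/-! ### The family of paths and its forbidden vertices -/

namespace ColoredPath

section Lists

variable {α : Type*}

theorem exists_split_first {Z : α → Prop} {q : List α} (h : ∃ a ∈ q, Z a) :
    ∃ q₁ a q₂, q = q₁ ++ a :: q₂ ∧ Z a ∧ ∀ x ∈ q₁, ¬ Z x := by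
  induction q with
  | nil => simp at h
  | cons x q ih =>
    by_cases hx : Z x
    · exact ⟨[], x, q, rfl, hx, by simp⟩
    · obtain ⟨q₁, a, q₂, rfl, ha, hq⟩ := ih (by simpa [hx] using h)
      exact ⟨x :: q₁, a, q₂, rfl, ha, by simpa [hx] using hq⟩

theorem exists_segment_of_mem {Z : α → Prop} {p q : List α} {y : α} (hy : ¬ Z y) (hp : ∃ a ∈ p, Z a)
    (hq : ∃ a ∈ q, Z a) : ∃ l₁ u l₂ u' l₃, p ++ y :: q = l₁ ++ u :: (l₂ ++ u' :: l₃) ∧ Z u ∧ Z u' ∧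
      (∀ x ∈ l₂, ¬ Z x) ∧ y ∈ l₂ := by
  obtain ⟨q₁, u', q₂, rfl, hu', hq₁⟩ := exists_split_first hq
  obtain ⟨p₁, u, p₂, hpe, hu, hp₁⟩ := exists_split_first (q := p.reverse) (Z := Z) (by simpa using hp)
  have : p = p₂.reverse ++ u :: p₁.reverse := by
    rw [← List.reverse_inj, hpe]; simp
  subst this
  refine ⟨p₂.reverse, u, p₁.reverse ++ y :: q₁, u', q₂, by simp, hu, hu', ?_, by simp⟩
  intro x hx
  simp only [List.mem_append, List.mem_reverse, List.mem_cons] at hx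
  rcases hx with hx | rfl | hx
  exacts [hp₁ x hx, hy, hq₁ x hx]

theorem successor_unique {a a' b b' : List α} {u w w' : α} (hn : (a ++ u :: w :: b).Nodup)
    (h : a ++ u :: w :: b = a' ++ u :: w' :: b') : w = w' := by
  induction a generalizing a' with
  | nil =>
    cases a' with
    | nil => simp at h; exact h.1
    | cons x a' =>
      simp only [List.nil_append, List.cons_append, List.cons.injEq] at h
      rw [List.nil_append, List.nodup_cons, h.2] at hn
      simp at hn
  | cons x a ih =>
    cases a' with
    | nil =>
      simp only [List.nil_append, List.cons_append, List.cons.injEq] at h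
      rw [List.cons_append, List.nodup_cons, h.1] at hn
      simp at hn
    | cons x' a' =>
      simp only [List.cons_append, List.cons.injEq] at h
      exact ih (List.nodup_cons.1 hn).2 h.2

theorem countP_eq_card_filter (l : List α) (p : α → Prop) [DecidablePred p] :
    l.countP (fun a => p a) = (Finset.univ.filter fun i : Fin l.length => p l[i]).card := by
  have h : l = (List.finRange l.length).map fun i => l[i] := by
    apply List.ext_getElem <;> simp
  conv_lhs => rw [h]
  rw [List.countP_map, List.countP_eq_length_filter]
  rfl

end Lists

namespace Instance

variable {n m : ℕ} (I : Instance n m)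

/-- The vertices that the walks `Q` may use after their start. -/
def Allowed (w : Fin n) : Prop := w ∉ I.U ∧ w ≠ I.s ∧ w ≠ I.v

instance : DecidablePred I.Allowed := fun _ => inferInstanceAs (Decidable (_ ∧ _ ∧ _))

variable {I}

theorem Admissible.two_le_length (hI : I.Admissible) : 2 ≤ I.paths.length := by
  have := hI.many
  have hb := hI.b_pos
  have : 1 ≤ (8 * I.k ^ 2 + 8 * I.k + 2) * (I.U.card + 1) * I.b :=
    Nat.one_le_iff_ne_zero.2 (by positivity)
  omega

theorem Admissible.color_index_unique (hI : I.Admissible) {i j : Fin I.paths.length} {c : Fin m}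
    (hi : c ∈ walkColors I.χ I.paths[i].1) (hj : c ∈ walkColors I.χ I.paths[j].1) : i = j := by
  have h := List.pairwise_iff_getElem.1 hI.colorDisjoint
  by_contra hij
  rcases lt_or_gt_of_ne hij with hlt | hlt
  · exact Finset.disjoint_left.1 (h i j i.2 j.2 hlt) hi hj
  · exact Finset.disjoint_left.1 (h j i j.2 i.2 hlt) hj hi

theorem Admissible.mem_support (hI : I.Admissible) {w : Fin n} (hw : ¬ I.Allowed w)
    (i : Fin I.paths.length) : w ∈ I.paths[i].1.support := by
  by_cases h1 : w ∈ I.U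
  · exact hI.visits _ (List.getElem_mem _) _ h1
  by_cases h2 : w = I.s
  · subst h2; simp
  by_cases h3 : w = I.v
  · subst h3; simp
  exact absurd ⟨h1, h2, h3⟩ hw

/-- A forbidden vertex lies on all paths, so a colour on it would be shared by two of them. -/
theorem Admissible.color_eq_empty (hI : I.Admissible) {w : Fin n} (hw : ¬ I.Allowed w) :
    I.χ w = ∅ := by
  by_contra h
  obtain ⟨c, hc⟩ := Finset.nonempty_iff_ne_empty.2 h
  have h2 := hI.two_le_length
  have := hI.color_index_unique (i := ⟨0, by omega⟩) (j := ⟨1, by omega⟩)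
    (mem_walkColors.2 ⟨w, hI.mem_support hw _, hc⟩) (mem_walkColors.2 ⟨w, hI.mem_support hw _, hc⟩)
  simp at this

/-- A path from a vertex to itself is trivial, so `s = v` would leave room for only one path in a
list without repetitions. -/
theorem Admissible.s_ne_v (hI : I.Admissible) : I.s ≠ I.v := by
  intro h
  have h2 := hI.two_le_length
  have : ∀ P Q : I.G.Path I.s I.v, P = Q := by
    obtain ⟨G, χ, s, t, v, k, b, U, paths⟩ := I
    dsimp only at h ⊢
    subst h
    intro P Q
    rw [SimpleGraph.Path.loop_eq P, SimpleGraph.Path.loop_eq Q]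
  have := (List.Nodup.getElem_inj_iff hI.nodup (i := 0) (j := 1) (hi := by omega) (hj := by omega)).1
    (this _ _)
  omega

/-- All paths visit `U ∪ {s, v}` in the same order. -/
theorem Admissible.filter_eq (hI : I.Admissible) (i j : Fin I.paths.length) :
    I.paths[i].1.support.filter (fun w => ¬ I.Allowed w) =
      I.paths[j].1.support.filter (fun w => ¬ I.Allowed w) := by
  -- With the ends split off, it no longer matters whether `s` or `v` belongs to `U`.
  have key : ∀ i : Fin I.paths.length, ∃ l, I.paths[i].1.support = I.s :: (l ++ [I.v]) ∧
      I.s ∉ l ∧ I.v ∉ l := by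
    intro i
    have hp := I.paths[i].2.support_nodup
    generalize I.paths[i].1 = W at hp
    have hsv := hI.s_ne_v
    obtain ⟨G, χ, s, t, v, k, b, U, paths⟩ := I
    dsimp only at *
    cases W with
    | nil => exact absurd rfl hsv
    | @cons _ w _ h W =>
      have hne := W.support_ne_nil
      refine ⟨W.support.dropLast, ?_, ?_, ?_⟩
      · rw [SimpleGraph.Walk.support_cons]
        congr
        conv_lhs => rw [← List.dropLast_append_getLast hne, SimpleGraph.Walk.getLast_support]
      · rw [SimpleGraph.Walk.support_cons, List.nodup_cons] at hp
        exact fun h => hp.1 (List.dropLast_subset _ h)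
      · rw [SimpleGraph.Walk.support_cons, List.nodup_cons] at hp
        intro h
        have h2 := hp.2
        rw [← List.dropLast_append_getLast hne, SimpleGraph.Walk.getLast_support] at h2
        exact (List.nodup_append.1 h2).2.2 v h v (by simp) rfl
  obtain ⟨l, hl, hs, hv⟩ := key i
  obtain ⟨l', hl', hs', hv'⟩ := key j
  have h := hI.sameOrder _ (List.getElem_mem i.2) _ (List.getElem_mem j.2)
  change I.paths[i].1.support.filter _ = I.paths[j].1.support.filter _ at h
  rw [hl, hl'] at h ⊢
  have hfil : ∀ l : List (Fin n), I.s ∉ l → I.v ∉ l →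
      l.filter (fun w => ¬ I.Allowed w) = l.filter (fun w => w ∈ I.U) := by
    intro l h1 h2
    refine List.filter_congr fun w hw => ?_
    have hs : w ≠ I.s := fun h => h1 (h ▸ hw)
    have hv : w ≠ I.v := fun h => h2 (h ▸ hw)
    simp [Allowed, hs, hv]
  have hmid : l.filter (fun w => w ∈ I.U) = l'.filter (fun w => w ∈ I.U) := by
    simp only [List.filter_cons, List.filter_append] at h
    split_ifs at h <;> simpa using h
  simp only [List.filter_cons, List.filter_append, hfil l hs hv, hfil l' hs' hv', hmid]

/-- A part of a path between consecutive vertices `u` and `u'` of `U ∪ {s, v}`, through `y`. -/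
theorem exists_segment (i : Fin I.paths.length) {y : Fin n}
    (hy : y ∈ I.paths[i].1.support) (hA : I.Allowed y) :
    ∃ l₁ u l₂ u' l₃, I.paths[i].1.support = l₁ ++ u :: (l₂ ++ u' :: l₃) ∧ ¬ I.Allowed u ∧
      ¬ I.Allowed u' ∧ (∀ x ∈ l₂, I.Allowed x) ∧ y ∈ l₂ := by
  obtain ⟨p, q, hpq⟩ := List.append_of_mem hy
  have hs : ¬ I.Allowed I.s := fun h => h.2.1 rfl
  have hv : ¬ I.Allowed I.v := fun h => h.2.2 rfl
  have h1 : ∃ a ∈ p, ¬ I.Allowed a := by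
    refine ⟨I.s, ?_, hs⟩
    have := I.paths[i].1.head_support
    simp only [hpq] at this
    cases p with
    | nil => exact absurd hA (by simp at this; rwa [this])
    | cons a p => simp at this; simp [this]
  have h2 : ∃ a ∈ q, ¬ I.Allowed a := by
    refine ⟨I.v, ?_, hv⟩
    have := I.paths[i].1.getLast_support
    simp only [hpq] at this
    cases hq : q with
    | nil => subst hq; exact absurd hA (by simp at this; rwa [this])
    | cons a q' =>
      subst hq
      rw [List.getLast_append_of_ne_nil (by simp) (by simp), List.getLast_cons (by simp)] at this
      rw [← this]; exact List.getLast_mem _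
  obtain ⟨l₁, u, l₂, u', l₃, h, hu, hu', hl, hyl⟩ :=
    exists_segment_of_mem (Z := fun a => ¬ I.Allowed a) (not_not.2 hA) h1 h2
  exact ⟨l₁, u, l₂, u', l₃, hpq.trans h, hu, hu', fun x hx => not_not.1 (hl x hx), hyl⟩

/-- The end of a segment is determined by its start. -/
theorem Admissible.segment_end_unique (hI : I.Admissible) {i j : Fin I.paths.length}
    {l₁ l₂ l₃ l₁' l₂' l₃' : List (Fin n)} {u w w' : Fin n}
    (h : I.paths[i].1.support = l₁ ++ u :: (l₂ ++ w :: l₃))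
    (h' : I.paths[j].1.support = l₁' ++ u :: (l₂' ++ w' :: l₃'))
    (hu : ¬ I.Allowed u) (hw : ¬ I.Allowed w) (hw' : ¬ I.Allowed w')
    (hl : ∀ x ∈ l₂, I.Allowed x) (hl' : ∀ x ∈ l₂', I.Allowed x) : w = w' := by
  have hf := hI.filter_eq i j
  have hn := (I.paths[i].2.support_nodup).filter (fun w => ¬ I.Allowed w)
  have e : ∀ l₂ : List (Fin n), (∀ x ∈ l₂, I.Allowed x) → l₂.filter (fun w => !decide (I.Allowed w)) = [] := by
    intro l h
    simpa [List.filter_eq_nil_iff] using h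
  rw [h, h'] at hf
  rw [h] at hn
  simp only [List.filter_append, List.filter_cons, e l₂ hl, e l₂' hl', hu, hw, hw', List.nil_append,
    decide_not, decide_false, Bool.not_false, if_true] at hf hn
  exact successor_unique hn hf

/-- The start of a segment has a successor on the path, so it is not `v`. Thus there are at most
`|U| + 1` possible starts, which is the factor in the assumed number of paths. -/
theorem segment_start_mem {i : Fin I.paths.length}
    {l₁ l₂ l₃ : List (Fin n)} {u w : Fin n}
    (h : I.paths[i].1.support = l₁ ++ u :: (l₂ ++ w :: l₃)) (hu : ¬ I.Allowed u) :
    u ∈ insert I.s I.U := by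
  have huv : u ≠ I.v := by
    rintro rfl
    have hn := I.paths[i].2.support_nodup
    have hlast := I.paths[i].1.getLast_support
    simp only [h] at hlast
    rw [h] at hn
    have hmem : I.v ∈ l₂ ++ w :: l₃ := by
      rw [List.getLast_append_of_ne_nil (by simp) (by simp), List.getLast_cons (by simp)] at hlast
      exact hlast ▸ List.getLast_mem (by simp)
    exact (List.nodup_cons.1 (List.nodup_append.1 hn).2.1).1 hmem
  by_contra hcon
  simp only [Finset.mem_insert, not_or] at hcon
  exact hu ⟨hcon.2, hcon.1, huv⟩

end Instance
end ColoredPath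

/-! ### Existence of a path without marked colours -/

namespace ColoredPath
namespace Instance

variable {n m : ℕ} {I : Instance n m}

/-- The connected sets used for one path: the part `R` of it between two consecutive vertices of
`U ∪ {s, v}`, a bypass `Γ` of this part, and a connection `T` from `t` to it. -/
structure Bridge (I : Instance n m) (i : Fin I.paths.length) where
  (u u' x y z : Fin n)
  (R Γ T : Set (Fin n))
  E : Finset (Fin n)
  K : Finset (Fin m)
  segment : ∃ l₁ l₂ l₃, I.paths[i].1.support = l₁ ++ u :: (l₂ ++ u' :: l₃) ∧ ∀ w ∈ l₂, I.Allowed w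
  u_forbidden : ¬ I.Allowed u
  u'_forbidden : ¬ I.Allowed u'
  R_allowed : ∀ w ∈ R, I.Allowed w ∧ w ∈ I.paths[i].1.support
  ux : I.G.Adj u x
  zu' : I.G.Adj z u'
  conn_R : ∀ a ∈ R, ∀ b ∈ R, Conn I.G R a b
  mem_x : x ∈ R
  mem_y : y ∈ R
  mem_z : z ∈ R
  conn_Γ : Conn I.G Γ x z
  conn_T : Conn I.G T I.t y
  E_allowed : ∀ w ∈ E, I.Allowed w
  union_sub : ∀ w ∈ Γ ∪ T, w ∈ E ∨ ∃ c ∈ walkColors I.χ I.paths[i].1 ∪ K, c ∈ I.χ w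
  card_E : E.card ≤ 2 * I.k - 1
  card_K : K.card ≤ I.k

/-- The marked colour sits on an allowed vertex `y`, and `R` is the segment around it. The bypass is
the skeleton of `R`, with at most `k - 1` extra vertices; the connection `T` retraces the search,
with at most `k` colours and `k` extra vertices. -/
theorem Admissible.exists_bridge (hI : I.Admissible) (ht : I.Allowed I.t) {i : Fin I.paths.length}
    {c : Fin m} (hc : c ∈ walkColors I.χ I.paths[i].1)
    (hm : marked I.G I.χ I.Allowed I.t (I.k - 1) c) : Nonempty (Bridge I i) := by
  obtain ⟨y, hy, hcy⟩ := mem_walkColors.1 hc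
  have hk : 1 ≤ I.k := (Finset.card_pos.2 ⟨c, hc⟩).trans_le (hI.valid _ (List.getElem_mem _))
  have hAy : I.Allowed y := by
    by_contra h
    simp [hI.color_eq_empty h] at hcy
  obtain ⟨l₁, u, l₂, u', l₃, hsup, hu, hu', hl₂, hyl⟩ := exists_segment i hy hAy
  have hchain := I.paths[i].1.isChain_adj_support
  rw [hsup] at hchain
  have hchain₁ := (List.isChain_append.1 hchain).2.1
  have hchain₂ : (l₂ ++ u' :: l₃).IsChain I.G.Adj := hchain₁.tail
  have hl₂c : l₂.IsChain I.G.Adj := (List.isChain_append.1 hchain₂).1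
  have hne : l₂ ≠ [] := List.ne_nil_of_mem hyl
  have hsub : ∀ w ∈ l₂, w ∈ I.paths[i].1.support := fun w hw => by rw [hsup]; simp [hw]
  have hux : I.G.Adj u (l₂.head hne) := by
    obtain ⟨x, l, rfl⟩ := List.exists_cons_of_ne_nil hne
    exact (List.isChain_cons_cons.1 hchain₁).1
  have hzu : I.G.Adj (l₂.getLast hne) u' :=
    (List.isChain_append.1 hchain₂).2.2 _ (List.getLast_mem_getLast? hne) _ (by simp)
  have hconn : ∀ a ∈ l₂, ∀ b ∈ l₂, Conn I.G {w | w ∈ l₂} a b := fun a ha b hb =>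
    Conn.of_isChain hl₂c ha hb
  obtain ⟨W, hW⟩ := hconn _ (List.head_mem hne) _ (List.getLast_mem hne)
  have hWsub : walkColors I.χ W ⊆ walkColors I.χ I.paths[i].1 := fun d hd => by
    obtain ⟨w, hw, hd⟩ := mem_walkColors.1 hd
    exact mem_walkColors.2 ⟨w, hsub w (hW w hw), hd⟩
  have hWcard : (walkColors I.χ W).card ≤ I.k - 1 + 1 := by
    have := (Finset.card_le_card hWsub).trans (hI.valid _ (List.getElem_mem _))
    omega
  -- Both ends of the segment are coloured, being neighbours of the uncoloured vertices `u` and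
  -- `u'`.
  obtain ⟨E, hE, hEcard, hΓ⟩ := exists_skeleton hI.irreducible hI.colorConnected (I.k - 1) W
    (fun h => hI.irreducible _ _ hux ((hI.color_eq_empty hu).trans h.symm))
    (fun h => hI.irreducible _ _ hzu (h.trans (hI.color_eq_empty hu').symm)) hWcard
  obtain ⟨K, E', hK, hE', hE'A, hT⟩ := exists_conn_of_marked hI.colorConnected ht hm hcy
  exact ⟨{ u := u, u' := u', x := _, y := y, z := _, R := {w | w ∈ l₂}, Γ := _, T := _
           E := E ∪ E', K := K
           segment := ⟨l₁, l₂, l₃, hsup, hl₂⟩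
           u_forbidden := hu
           u'_forbidden := hu'
           R_allowed := fun w hw => ⟨hl₂ w hw, hsub w hw⟩
           ux := hux
           zu' := hzu
           conn_R := hconn
           mem_x := List.head_mem hne
           mem_y := hyl
           mem_z := List.getLast_mem hne
           conn_Γ := hΓ
           conn_T := hT
           E_allowed := fun w hw => (Finset.mem_union.1 hw).elim
             (fun h => hl₂ w (hW w (hE w h))) (hE'A w)
           union_sub := by
             rintro w ((h | ⟨d, hd, hdw⟩) | (h | ⟨d, hd, hdw⟩))
             · exact Or.inl (Finset.mem_union_left _ h)
             · exact Or.inr ⟨d, Finset.mem_union_left _ (hWsub hd), hdw⟩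
             · exact Or.inl (Finset.mem_union_right _ h)
             · exact Or.inr ⟨d, Finset.mem_union_right _ hd, hdw⟩
           card_E := (Finset.card_union_le _ _).trans (by omega)
           card_K := by omega }⟩

theorem Admissible.card_paths_through (hI : I.Admissible) {w : Fin n} (hw : I.Allowed w) :
    (Finset.univ.filter fun j : Fin I.paths.length => w ∈ I.paths[j].1.support).card ≤ I.b - 1 := by
  have := hI.fewShare w hw.1 hw.2.1 hw.2.2
  rw [countP_eq_card_filter] at this
  exact Nat.le_sub_one_of_lt this

theorem Admissible.card_paths_with_color (hI : I.Admissible) (c : Fin m) :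
    (Finset.univ.filter fun j : Fin I.paths.length => c ∈ walkColors I.χ I.paths[j].1).card ≤ 1 := by
  refine Finset.card_le_one.2 fun i hi j hj => ?_
  exact hI.color_index_unique (Finset.mem_filter.1 hi).2 (Finset.mem_filter.1 hj).2

/-- The bypass and the connection to `t` touch few other paths. -/
theorem Bridge.card_touched (hI : I.Admissible) {i : Fin I.paths.length} (B : Bridge I i) (hk : 1 ≤ I.k)
    (A : Finset (Fin I.paths.length))
    (hA : ∀ j ∈ A, j ≠ i ∧ ∃ w ∈ B.Γ ∪ B.T, w ∈ I.paths[j].1.support) :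
    A.card ≤ (2 * I.k - 1) * I.b := by
  have hsub : A ⊆ (B.E.biUnion fun w => Finset.univ.filter fun j => w ∈ I.paths[j].1.support) ∪
      B.K.biUnion fun c => Finset.univ.filter fun j => c ∈ walkColors I.χ I.paths[j].1 := by
    intro j hj
    obtain ⟨hji, w, hw, hwj⟩ := hA j hj
    simp only [Finset.mem_union, Finset.mem_biUnion, Finset.mem_filter, Finset.mem_univ, true_and]
    rcases B.union_sub w hw with h | ⟨c, hc, hcw⟩
    · exact Or.inl ⟨w, h, hwj⟩
    · have hcj : c ∈ walkColors I.χ I.paths[j].1 := mem_walkColors.2 ⟨w, hwj, hcw⟩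
      rcases Finset.mem_union.1 hc with hc | hc
      · exact absurd (hI.color_index_unique hcj hc) hji
      · exact Or.inr ⟨c, hc, hcj⟩
  have h1 := Finset.card_biUnion_le_card_mul B.E
    (fun w => Finset.univ.filter fun j : Fin I.paths.length => w ∈ I.paths[j].1.support) (I.b - 1)
    fun w hw => hI.card_paths_through (B.E_allowed w hw)
  have h2 := Finset.card_biUnion_le_card_mul B.K
    (fun c => Finset.univ.filter fun j : Fin I.paths.length => c ∈ walkColors I.χ I.paths[j].1) 1
    fun c _ => hI.card_paths_with_color c
  have h3 := (Finset.card_le_card hsub).trans (Finset.card_union_le _ _)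
  have h4 : B.E.card * (I.b - 1) ≤ (2 * I.k - 1) * (I.b - 1) := Nat.mul_le_mul_right _ B.card_E
  have h5 := B.card_K
  -- The vertices of `E` touch at most `(2k-1)(b-1)` paths and the colours of `K` at most `k ≤
  -- 2k-1`; the colours of path `i` touch no other path.
  have h6 : (2 * I.k - 1) * I.b = (2 * I.k - 1) * (I.b - 1) + (2 * I.k - 1) := by
    obtain ⟨b, hb⟩ : ∃ b, I.b = b + 1 := ⟨I.b - 1, by have := hI.b_pos; omega⟩
    rw [hb, Nat.add_sub_cancel]; ring
  omega

/-- Some path has no colour that is found from `t` within `k` rounds. -/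
theorem Admissible.exists_unmarked (hI : I.Admissible) (ht : I.Allowed I.t) :
    ∃ i : Fin I.paths.length, ∀ c ∈ walkColors I.χ I.paths[i].1,
      ¬ marked I.G I.χ I.Allowed I.t (I.k - 1) c := by
  by_contra! hcon
  have hB : ∀ i : Fin I.paths.length, Nonempty (Bridge I i) := fun i =>
    let ⟨_, hc, hm⟩ := hcon i
    hI.exists_bridge ht hc hm
  have B : ∀ i, Bridge I i := fun i => (hB i).some
  have hk : 1 ≤ I.k := by
    obtain ⟨c, hc, -⟩ := hcon ⟨0, by have := hI.two_le_length; omega⟩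
    exact (Finset.card_pos.2 ⟨c, hc⟩).trans_le (hI.valid _ (List.getElem_mem _))
  obtain ⟨u, -, hu⟩ := Finset.exists_lt_card_fiber_of_mul_lt_card_of_maps_to
    (s := (Finset.univ : Finset (Fin I.paths.length))) (t := insert I.s I.U) (f := fun i => (B i).u)
    (n := (8 * I.k ^ 2 + 8 * I.k + 2) * I.b)
    (fun i _ => by
      obtain ⟨l₁, l₂, l₃, h, -⟩ := (B i).segment
      exact segment_start_mem h (B i).u_forbidden)
    (by
      have h1 := Finset.card_insert_le I.s I.U
      have h2 := hI.many
      calc _ ≤ (I.U.card + 1) * ((8 * I.k ^ 2 + 8 * I.k + 2) * I.b) := Nat.mul_le_mul_right _ h1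
        _ = (8 * I.k ^ 2 + 8 * I.k + 2) * (I.U.card + 1) * I.b := by ring
        _ < _ := by simpa using h2)
  set J := Finset.univ.filter fun i => (B i).u = u with hJ
  -- This is what six independent paths cost when outdegrees are at most `(2k-1)b`. The coefficient
  -- `8k²+8k+2` exceeds `10(2k-1)` by `8k²-12k+12 ≥ 8`, which absorbs the remaining `5`.
  have hJlt : 5 * (2 * ((2 * I.k - 1) * I.b) + 1) < J.card := by
    refine lt_of_le_of_lt ?_ hu
    have hb := hI.b_pos
    obtain ⟨k, hk'⟩ : ∃ k, I.k = k + 1 := ⟨I.k - 1, by omega⟩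
    obtain ⟨b, hb'⟩ : ∃ b, I.b = b + 1 := ⟨I.b - 1, by omega⟩
    have : 2 * I.k - 1 = 2 * k + 1 := by omega
    rw [this, hk', hb']
    have h1 : 8 ≤ (8 * k ^ 2 + 4 * k + 8) * (b + 1) :=
      (by omega : 8 ≤ (8 * k ^ 2 + 4 * k + 8) * 1).trans (Nat.mul_le_mul_left _ (by omega))
    calc _ ≤ (20 * k + 10) * (b + 1) + (8 * k ^ 2 + 4 * k + 8) * (b + 1) := by
          have : 5 * (2 * ((2 * k + 1) * (b + 1)) + 1) = (20 * k + 10) * (b + 1) + 5 := by ring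
          omega
      _ = _ := by ring
  obtain ⟨A, hAJ, hAcard, hA⟩ := exists_independent
    (fun i j => ∃ w ∈ (B i).Γ ∪ (B i).T, w ∈ I.paths[j].1.support) ((2 * I.k - 1) * I.b) 5 J
    (fun i _ A _ hA => (B i).card_touched hI hk A hA) hJlt
  let f : Fin 6 → Fin I.paths.length := fun a => A.orderEmbOfFin hAcard a
  have hfA : ∀ a, f a ∈ A := fun a => A.orderEmbOfFin_mem hAcard a
  have hfinj : ∀ a a', a ≠ a' → f a ≠ f a' := fun a a' h => (A.orderEmbOfFin hAcard).injective.ne h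
  have hfu : ∀ a, (B (f a)).u = u := fun a => (Finset.mem_filter.1 (hAJ (hfA a))).2
  have hfu' : ∀ a, (B (f a)).u' = (B (f 0)).u' := by
    intro a
    obtain ⟨l₁, l₂, l₃, h, hl⟩ := (B (f a)).segment
    obtain ⟨l₁', l₂', l₃', h', hl'⟩ := (B (f 0)).segment
    rw [hfu] at h h'
    exact hI.segment_end_unique h h' (hfu 0 ▸ (B (f 0)).u_forbidden) (B (f a)).u'_forbidden
      (B (f 0)).u'_forbidden hl hl'
  set u' := (B (f 0)).u' with hu'
  have huA : ¬ I.Allowed u := hfu 0 ▸ (B (f 0)).u_forbidden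
  have hu'A : ¬ I.Allowed u' := (B (f 0)).u'_forbidden
  have huu : u ≠ u' := by
    obtain ⟨l₁, l₂, l₃, h, -⟩ := (B (f 0)).segment
    have hn := I.paths[f 0].2.support_nodup
    rw [h, hfu 0] at hn
    rintro rfl
    exact (List.nodup_cons.1 (List.nodup_append.1 hn).2.1).1 (by simp [← hu'])
  -- Colour classes contain no forbidden vertex, since these are uncoloured; the extra vertices in
  -- `E` are allowed.
  have hforb : ∀ {w}, ¬ I.Allowed w → ∀ a, w ∉ (B (f a)).R ∧ w ∉ (B (f a)).Γ ∪ (B (f a)).T := by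
    intro w hw a
    refine ⟨fun h => hw ((B (f a)).R_allowed w h).1, fun h => ?_⟩
    rcases (B (f a)).union_sub w h with h | ⟨c, -, hc⟩
    · exact hw ((B (f a)).E_allowed w h)
    · simp [hI.color_eq_empty hw] at hc
  have hdisj : ∀ a a', a ≠ a' → Disjoint ((B (f a)).Γ ∪ (B (f a)).T) (B (f a')).R := by
    intro a a' haa'
    refine Set.disjoint_left.2 fun w hw hwR => ?_
    exact hA _ (hfA a) _ (hfA a') (hfinj a a' haa') ⟨w, hw, ((B (f a')).R_allowed w hwR).2⟩
  exact hI.planar.not_six (t := I.t) (R := fun a => (B (f a)).R) (Γ := fun a => (B (f a)).Γ)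
    (T := fun a => (B (f a)).T) (x := fun a => (B (f a)).x) (y := fun a => (B (f a)).y)
    (z := fun a => (B (f a)).z) huu (fun a => hfu a ▸ (B (f a)).ux) (fun a => hfu' a ▸ (B (f a)).zu')
    (fun a => (B (f a)).mem_x) (fun a => (B (f a)).mem_y) (fun a => (B (f a)).mem_z)
    (fun a w hw => (B (f a)).conn_R _ (B (f a)).mem_x _ hw)
    (fun a => (B (f a)).conn_Γ) (fun a => (B (f a)).conn_T)
    (fun a => ⟨(hforb huA a).1, (hforb hu'A a).1⟩)
    (fun a => ⟨fun h => (hforb huA a).2 (Or.inl h), fun h => (hforb hu'A a).2 (Or.inl h)⟩)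
    (fun a => ⟨fun h => (hforb huA a).2 (Or.inr h), fun h => (hforb hu'A a).2 (Or.inr h)⟩)
    (fun a a' h => (hdisj a a' h).mono_left Set.subset_union_left)
    (fun a a' h => (hdisj a a' h).mono_left Set.subset_union_right)

/-- A path without marked colours shares no colour with the valid walks to `t`. -/
theorem Admissible.disjoint_of_unmarked (hI : I.Admissible) {i : Fin I.paths.length}
    (h : I.Allowed I.t → ∀ c ∈ walkColors I.χ I.paths[i].1,
      ¬ marked I.G I.χ I.Allowed I.t (I.k - 1) c)
    (Q : I.G.Walk I.v I.t) (hQ : IsValid I.χ I.k Q)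
    (hQA : ∀ w ∈ Q.support.tail, w ∉ I.U ∧ w ≠ I.s ∧ w ≠ I.v) :
    Disjoint (walkColors I.χ I.paths[i].1) (walkColors I.χ Q) := by
  refine Finset.disjoint_left.2 fun c hc hcQ => ?_
  obtain ⟨w, hw, hcw⟩ := mem_walkColors.1 hcQ
  have hwA : I.Allowed w := by
    by_contra h
    simp [hI.color_eq_empty h] at hcw
  have hwv := hwA.2.2
  -- The part of `Q` from `w` on, read backwards, is a walk from `t` through allowed vertices. In
  -- particular `t` is allowed, so for a forbidden `t` no colour can be shared at all.
  have key : ∀ (v : Fin n) (Q : I.G.Walk v I.t), w ∈ Q.support → w ≠ v →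
      (∀ w ∈ Q.support.tail, I.Allowed w) → (walkColors I.χ Q).card ≤ I.k →
      I.Allowed I.t ∧ ∃ W : I.G.Walk I.t w, (∀ x ∈ W.support, I.Allowed x) ∧
        (walkColors I.χ W).card ≤ I.k := by
    intro v Q hw hwv hQA hQ
    cases Q with
    | nil => simp at hw; exact absurd hw hwv
    | @cons _ b _ hvb Q =>
      have hwQ : w ∈ Q.support := by
        rcases List.mem_cons.1 (by simpa using hw) with h | h
        exacts [absurd h hwv, h]
      simp only [SimpleGraph.Walk.support_cons, List.tail_cons] at hQA
      have hs : ∀ x ∈ (Q.dropUntil w hwQ).reverse.support, x ∈ Q.support := fun x hx => by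
        rw [SimpleGraph.Walk.support_reverse, List.mem_reverse] at hx
        exact Q.support_dropUntil_subset_support hwQ hx
      refine ⟨hQA _ (by simp), (Q.dropUntil w hwQ).reverse, fun x hx => hQA x (hs x hx), ?_⟩
      refine (Finset.card_le_card fun d hd => ?_).trans hQ
      obtain ⟨x, hx, hd⟩ := mem_walkColors.1 hd
      exact mem_walkColors.2 ⟨x, by simp [hs x hx], hd⟩
  obtain ⟨htA, W, hWA, hW⟩ := key _ Q hw hwv hQA hQ
  exact h htA c hc (marked_of_walk_start hI.irreducible W hWA hW hcw)

end Instance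
end ColoredPath

/-! ### A structured language with running-time bounds, compiled to the machine -/

namespace RAM

/-- What a program sees of a state: forty registers and the memory. The other registers are scratch. -/
@[ext]
structure Env where
  reg : Fin 40 → ℕ
  mem : ℕ → ℕ

namespace Env

/-- Assignment to a register. -/
def set (ε : Env) (x : Fin 40) (a : ℕ) : Env := ⟨Function.update ε.reg x a, ε.mem⟩

/-- Assignment to a memory cell. -/
def write (ε : Env) (i a : ℕ) : Env := ⟨ε.reg, Function.update ε.mem i a⟩

@[simp] theorem set_mem (ε : Env) (x : Fin 40) (a : ℕ) : (ε.set x a).mem = ε.mem := rfl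
@[simp] theorem write_reg (ε : Env) (i a : ℕ) : (ε.write i a).reg = ε.reg := rfl
@[simp] theorem set_reg_self (ε : Env) (x : Fin 40) (a : ℕ) : (ε.set x a).reg x = a := by simp [set]
theorem set_reg (ε : Env) (x y : Fin 40) (a : ℕ) :
    (ε.set x a).reg y = if y = x then a else ε.reg y := by simp [set, Function.update_apply]
theorem set_reg_of_ne (ε : Env) {x y : Fin 40} (a : ℕ) (h : y ≠ x) : (ε.set x a).reg y = ε.reg y := by
  simp [set_reg, h]
theorem write_mem (ε : Env) (i j a : ℕ) :
    (ε.write i a).mem j = if j = i then a else ε.mem j := by simp [write, Function.update_apply]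

end Env

def State.env (σ : State) : Env := ⟨fun x => σ.reg x, σ.mem⟩

/-- Expressions over registers and memory. -/
inductive Expr
  | var (x : Fin 40)
  | lit (a : ℕ)
  | add (a b : Expr)
  | sub (a b : Expr)
  | mul (a b : Expr)
  | rd (a : Expr)

namespace Expr

def eval : Expr → Env → ℕ
  | var x, ε => ε.reg x
  | lit a, _ => a
  | add a b, ε => a.eval ε + b.eval ε
  | sub a b, ε => a.eval ε - b.eval ε
  | mul a b, ε => a.eval ε * b.eval ε
  | rd a, ε => ε.mem (a.eval ε)

/-- Every left factor is at most `L`: multiplication is repeated addition. -/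
def Bounded (L : ℕ) : Expr → Env → Prop
  | var _, _ => True
  | lit _, _ => True
  | add a b, ε => a.Bounded L ε ∧ b.Bounded L ε
  | sub a b, ε => a.Bounded L ε ∧ b.Bounded L ε
  | mul a b, ε => a.Bounded L ε ∧ b.Bounded L ε ∧ a.eval ε ≤ L
  | rd a, ε => a.Bounded L ε

/-- The program that computes an expression into register `d`, using the registers from `d` on. -/
def compile : Expr → ℕ → Prog
  | var x, d => .seq (.const d 0) (.add d x d)
  | lit a, d => .const d a
  | add a b, d => .seq (a.compile d) (.seq (b.compile (d + 1)) (.add d d (d + 1)))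
  | sub a b, d => .seq (a.compile d) (.seq (b.compile (d + 1)) (.sub d d (d + 1)))
  | mul a b, d => .seq (a.compile d) (.seq (b.compile (d + 1)) (.seq (.const (d + 2) 0)
      (.seq (.const (d + 3) 1) (.seq (.whileNonzero d
        (.seq (.add (d + 2) (d + 2) (d + 1)) (.sub d d (d + 3)))) (.add d d (d + 2))))))
  | rd a, d => .seq (a.compile d) (.load d d)

noncomputable def cost : Expr → Polynomial ℕ
  | var _ => 2
  | lit _ => 1
  | add a b => a.cost + b.cost + 1
  | sub a b => a.cost + b.cost + 1
  | mul a b => a.cost + b.cost + 3 * .X + 4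
  | rd a => a.cost + 1

theorem exec_mul_loop (d : ℕ) (N : ℕ) : ∀ σ : State, σ.reg d = N → σ.reg (d + 3) = 1 →
    ∃ σ', Exec (.whileNonzero d (.seq (.add (d + 2) (d + 2) (d + 1)) (.sub d d (d + 3)))) σ σ' (3 * N + 1) ∧
      σ'.mem = σ.mem ∧ (∀ r < d, σ'.reg r = σ.reg r) ∧ σ'.reg d = 0 ∧
      σ'.reg (d + 2) = σ.reg (d + 2) + N * σ.reg (d + 1) := by
  induction N with
  | zero => exact fun σ h _ => ⟨σ, .whileStop h, rfl, fun _ _ => rfl, h, by simp⟩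
  | succ N ih =>
    intro σ h h3
    have e := Exec.seq (.add (d + 2) (d + 2) (d + 1) σ) (.sub d d (d + 3) _)
    obtain ⟨σ', he, hm, hr, h0, h2⟩ := ih ⟨Function.update (Function.update σ.reg (d + 2)
      (σ.reg (d + 2) + σ.reg (d + 1))) d N, σ.mem⟩ (by simp) (by simp [h3])
    refine ⟨σ', ?_, hm, ?_, h0, ?_⟩
    · convert Exec.whileStep (x := d) (by omega) e (T' := 3 * N + 1) ?_ using 1
      · ring
      · convert he using 3
        simp [h, h3]
    · intro r hrd
      rw [hr r hrd]
      have h2 : r ≠ d + 2 := by omega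
      simp [hrd.ne, h2]
    · rw [h2]
      simp; ring

/-- Registers below `d` are left alone, so a first operand in `d` survives the computation of the
second in `d + 1`. `Bounded` is needed for the time only; the value is right without it. -/
theorem exec_compile (L : ℕ) (e : Expr) : ∀ (d : ℕ), 40 ≤ d → ∀ σ : State, ∃ σ' T,
    Exec (e.compile d) σ σ' T ∧ σ'.mem = σ.mem ∧ (∀ r < d, σ'.reg r = σ.reg r) ∧
      σ'.reg d = e.eval σ.env ∧ (e.Bounded L σ.env → T ≤ e.cost.eval L) := by
  have henv : ∀ {d : ℕ}, 40 ≤ d → ∀ {σ σ' : State}, σ'.mem = σ.mem → (∀ r < d, σ'.reg r = σ.reg r) →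
      σ'.env = σ.env := by
    intro d hd σ σ' hm hr
    ext x
    · exact hr x (by omega)
    · simp [State.env, hm]
  induction e with
  | var x =>
    intro d hd σ
    have hx : (x : ℕ) ≠ d := by omega
    refine ⟨_, _, .seq (.const d 0 σ) (.add d x d _), rfl, fun r hr => ?_, ?_, fun _ => ?_⟩
    · simp [hr.ne]
    · simp [hx, eval, State.env]
    · simp [cost]
  | lit a =>
    intro d hd σ
    refine ⟨_, _, .const d a σ, rfl, fun r hr => ?_, ?_, fun _ => ?_⟩
    · simp [hr.ne]
    · simp [eval]
    · simp [cost]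
  | add a b iha ihb =>
    intro d hd σ
    obtain ⟨σ₁, T₁, e₁, m₁, r₁, v₁, t₁⟩ := iha d hd σ
    obtain ⟨σ₂, T₂, e₂, m₂, r₂, v₂, t₂⟩ := ihb (d + 1) (by omega) σ₁
    have h₁ := henv hd m₁ r₁
    refine ⟨_, _, .seq e₁ (.seq e₂ (.add d d (d + 1) _)), m₂.trans m₁, fun r hr => ?_, ?_, fun hB => ?_⟩
    · simp [hr.ne, r₂ r (by omega), r₁ r hr]
    · simp [eval, r₂ d (by omega), v₁, v₂, h₁]
    · have := t₁ hB.1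
      have := t₂ (h₁ ▸ hB.2)
      simp only [cost, Polynomial.eval_add, Polynomial.eval_one]
      omega
  | sub a b iha ihb =>
    intro d hd σ
    obtain ⟨σ₁, T₁, e₁, m₁, r₁, v₁, t₁⟩ := iha d hd σ
    obtain ⟨σ₂, T₂, e₂, m₂, r₂, v₂, t₂⟩ := ihb (d + 1) (by omega) σ₁
    have h₁ := henv hd m₁ r₁
    refine ⟨_, _, .seq e₁ (.seq e₂ (.sub d d (d + 1) _)), m₂.trans m₁, fun r hr => ?_, ?_, fun hB => ?_⟩
    · simp [hr.ne, r₂ r (by omega), r₁ r hr]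
    · simp [eval, r₂ d (by omega), v₁, v₂, h₁]
    · have := t₁ hB.1
      have := t₂ (h₁ ▸ hB.2)
      simp only [cost, Polynomial.eval_add, Polynomial.eval_one]
      omega
  | mul a b iha ihb =>
    intro d hd σ
    obtain ⟨σ₁, T₁, e₁, m₁, r₁, v₁, t₁⟩ := iha d hd σ
    obtain ⟨σ₂, T₂, e₂, m₂, r₂, v₂, t₂⟩ := ihb (d + 1) (by omega) σ₁
    have h₁ := henv hd m₁ r₁
    obtain ⟨σ₃, e₃, m₃, r₃, v₃, w₃⟩ := exec_mul_loop d (a.eval σ.env)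
      ⟨Function.update (Function.update σ₂.reg (d + 2) 0) (d + 3) 1, σ₂.mem⟩
      (by simp [r₂ d (by omega), v₁]) (by simp)
    refine ⟨_, _, .seq e₁ (.seq e₂ (.seq (.const (d + 2) 0 σ₂) (.seq (.const (d + 3) 1 _)
      (.seq e₃ (.add d d (d + 2) _))))), m₃.trans (m₂.trans m₁), fun r hr => ?_, ?_, fun hB => ?_⟩
    · have h2 : r ≠ d + 2 := by omega
      have h3 : r ≠ d + 3 := by omega
      simp [hr.ne, r₃ r hr, h2, h3, r₂ r (by omega), r₁ r hr]
    · simp [eval, v₃, w₃, v₂, h₁]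
    · have := t₁ hB.1
      have := t₂ (h₁ ▸ hB.2.1)
      have := hB.2.2
      simp only [cost, Polynomial.eval_add, Polynomial.eval_mul, Polynomial.eval_X,
        Polynomial.eval_ofNat]
      omega
  | rd a iha =>
    intro d hd σ
    obtain ⟨σ₁, T₁, e₁, m₁, r₁, v₁, t₁⟩ := iha d hd σ
    refine ⟨_, _, .seq e₁ (.load d d _), m₁, fun r hr => ?_, ?_, fun hB => ?_⟩
    · simp [hr.ne, r₁ r hr]
    · simp [eval, v₁, m₁, State.env]
    · have := t₁ hB
      simp only [cost, Polynomial.eval_add, Polynomial.eval_one]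
      omega

end Expr

/-- Commands with bounded loops: `loop x b c` runs `c` for `x = 0, …, b - 1`. -/
inductive Cmd
  | assign (x : Fin 40) (e : Expr)
  | write (a e : Expr)
  | seq (c d : Cmd)
  | cond (e : Expr) (c : Cmd)
  | loop (x b : Fin 40) (c : Cmd)

namespace Cmd

def compile : Cmd → Prog
  | assign x e => .seq (e.compile 40) (.seq (.const 41 0) (.add x 40 41))
  | write a e => .seq (a.compile 40) (.seq (e.compile 41) (.store 40 41))
  | seq c d => .seq c.compile d.compile
  | cond e c => .seq (e.compile 40) (.ifNonzero 40 c.compile (.const 40 0))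
  | loop x b c => .seq (.const x 0) (.seq (.sub 40 b x) (.whileNonzero 40
      (.seq c.compile (.seq (.const 41 1) (.seq (.add x x 41) (.sub 40 b x))))))

noncomputable def cost : Cmd → Polynomial ℕ
  | assign _ e => e.cost + 2
  | write a e => a.cost + e.cost + 1
  | seq c d => c.cost + d.cost
  | cond e c => e.cost + c.cost + 2
  | loop _ _ c => .X * (c.cost + 4) + 3

/-- Started in `ε`, the command halts within its cost (with loops counted as `L` rounds) in a state
satisfying `Q`. -/
def Runs (L : ℕ) (c : Cmd) (ε : Env) (Q : Env → Prop) : Prop :=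
  ∀ σ : State, σ.env = ε → ∃ σ' T, Exec c.compile σ σ' T ∧ T ≤ c.cost.eval L ∧ Q σ'.env

variable {L : ℕ} {ε : Env} {Q Q' : Env → Prop}

theorem Runs.mono {c : Cmd} (h : Runs L c ε Q') (hQ : ∀ ε, Q' ε → Q ε) : Runs L c ε Q := fun σ hσ =>
  let ⟨σ', T, h1, h2, h3⟩ := h σ hσ
  ⟨σ', T, h1, h2, hQ _ h3⟩

theorem Runs.assign {x : Fin 40} {e : Expr} (hB : e.Bounded L ε) (hQ : Q (ε.set x (e.eval ε))) :
    Runs L (assign x e) ε Q := by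
  rintro σ rfl
  obtain ⟨σ₁, T₁, e₁, m₁, r₁, v₁, t₁⟩ := e.exec_compile L 40 le_rfl σ
  refine ⟨_, _, .seq e₁ (.seq (.const 41 0 _) (.add x 40 41 _)), ?_, ?_⟩
  · have := t₁ hB
    simp only [cost, Polynomial.eval_add, Polynomial.eval_ofNat]
    omega
  · convert hQ
    ext y
    · have hy : (y : ℕ) ≠ 41 := by omega
      simp [State.env, Env.set, Function.update_apply, hy, v₁, r₁ y y.2, Fin.ext_iff]
    · simp [State.env, m₁]

theorem Runs.write {a e : Expr} (hA : a.Bounded L ε) (hB : e.Bounded L ε)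
    (hQ : Q (ε.write (a.eval ε) (e.eval ε))) : Runs L (write a e) ε Q := by
  rintro σ rfl
  obtain ⟨σ₁, T₁, e₁, m₁, r₁, v₁, t₁⟩ := a.exec_compile L 40 le_rfl σ
  obtain ⟨σ₂, T₂, e₂, m₂, r₂, v₂, t₂⟩ := e.exec_compile L 41 (by omega) σ₁
  have h₁ : σ₁.env = σ.env := by
    ext x
    · exact r₁ x x.2
    · simp [State.env, m₁]
  refine ⟨_, _, .seq e₁ (.seq e₂ (.store 40 41 _)), ?_, ?_⟩
  · have := t₁ hA
    have := t₂ (h₁ ▸ hB)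
    simp only [cost, Polynomial.eval_add, Polynomial.eval_one]
    omega
  · convert hQ
    ext y
    · simp [State.env, r₂ y (by omega), r₁ y y.2]
    · rw [h₁] at v₂
      simp [State.env, Env.write, m₂, m₁, r₂ 40, v₁, v₂]

theorem Runs.seq {c d : Cmd} (h : Runs L c ε fun ε' => Runs L d ε' Q) : Runs L (seq c d) ε Q := by
  intro σ hσ
  obtain ⟨σ₁, T₁, e₁, t₁, h₁⟩ := h σ hσ
  obtain ⟨σ₂, T₂, e₂, t₂, h₂⟩ := h₁ σ₁ rfl
  refine ⟨σ₂, _, .seq e₁ e₂, ?_, h₂⟩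
  simp only [cost, Polynomial.eval_add]
  omega

theorem Runs.cond {e : Expr} {c : Cmd} (hB : e.Bounded L ε) (h : e.eval ε ≠ 0 → Runs L c ε Q)
    (h' : e.eval ε = 0 → Q ε) : Runs L (cond e c) ε Q := by
  rintro σ rfl
  obtain ⟨σ₁, T₁, e₁, m₁, r₁, v₁, t₁⟩ := e.exec_compile L 40 le_rfl σ
  have h₁ : σ₁.env = σ.env := by
    ext x
    · exact r₁ x x.2
    · simp [State.env, m₁]
  have := t₁ hB
  by_cases he : e.eval σ.env = 0
  · refine ⟨_, _, .seq e₁ (.ifFalse (v₁.trans he) (.const 40 0 _)), ?_, ?_⟩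
    · simp only [cost, Polynomial.eval_add, Polynomial.eval_ofNat]
      omega
    · have henv : State.env ⟨Function.update σ₁.reg 40 0, σ₁.mem⟩ = σ.env := by
        rw [← h₁]
        ext x
        · have hx : (x : ℕ) ≠ 40 := by omega
          simp [State.env, Function.update_apply, hx]
        · rfl
      change Q (State.env ⟨Function.update σ₁.reg 40 0, σ₁.mem⟩)
      rw [henv]
      exact h' he
  · obtain ⟨σ₂, T₂, e₂, t₂, h₂⟩ := h he σ₁ h₁
    refine ⟨σ₂, _, .seq e₁ (.ifTrue (v₁ ▸ he) e₂), ?_, h₂⟩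
    simp only [cost, Polynomial.eval_add, Polynomial.eval_ofNat]
    omega

/-- The test register is recomputed as `b - x` after every round, so the body may destroy scratch
registers but must preserve the counter and the bound. The invariant describes the state after the
counter has been set. -/
theorem Runs.loop {x b : Fin 40} {c : Cmd} (Inv : ℕ → Env → Prop) {N : ℕ} (hN : N ≤ L)
    (hb : ∀ j ε, Inv j ε → ε.reg b = N)
    (h0 : Inv 0 (ε.set x 0))
    (hc : ∀ j < N, ∀ ε, Inv j ε → Runs L c ε fun ε' => ε'.reg x = j ∧ Inv (j + 1) (ε'.set x (j + 1)))
    (hQ : ∀ ε, Inv N ε → Q ε) : Runs L (loop x b c) ε Q := by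
  have hx40 : (x : ℕ) ≠ 40 := by omega
  have hx41 : (x : ℕ) ≠ 41 := by omega
  have hb40 : (b : ℕ) ≠ 40 := by omega
  have hb41 : (b : ℕ) ≠ 41 := by omega
  -- Here `r` counts the rounds left. A round costs its body and four steps: the test, the constant,
  -- the increment and the new difference.
  have key : ∀ r j : ℕ, j + r = N → ∀ σ : State, Inv j σ.env → σ.reg 40 = r → ∃ σ' T,
      Exec (.whileNonzero 40 (.seq c.compile (.seq (.const 41 1) (.seq (.add x x 41) (.sub 40 b x)))))
        σ σ' T ∧ T ≤ r * (c.cost.eval L + 4) + 1 ∧ Inv N σ'.env := by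
    intro r
    induction r with
    | zero =>
      rintro j rfl σ hI h
      exact ⟨σ, 1, .whileStop h, by omega, hI⟩
    | succ r ih =>
      intro j hj σ hI h
      obtain ⟨σ₁, T₁, e₁, t₁, hx₁, h₁⟩ := hc j (by omega) _ hI σ rfl
      have e₂ := Exec.seq e₁ (.seq (.const 41 1 σ₁) (.seq (.add x x 41 _) (.sub 40 b x _)))
      have hx₁' : σ₁.reg x = j := hx₁
      have henv : State.env ⟨Function.update (Function.update (Function.update σ₁.reg 41 1) x (j + 1))
          40 r, σ₁.mem⟩ = σ₁.env.set x (j + 1) := by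
        ext y
        · have hy : (y : ℕ) ≠ 40 := by omega
          have hy' : (y : ℕ) ≠ 41 := by omega
          simp [State.env, Env.set, Function.update_apply, hy, hy', Fin.ext_iff]
        · rfl
      have hbN : (Function.update (Function.update σ₁.reg 41 1) (x : ℕ) (j + 1)) b = N := by
        have := hb _ _ h₁
        simp only [Env.set, State.env, Function.update_apply, Fin.ext_iff] at this ⊢
        simpa [hb41] using this
      obtain ⟨σ', T', e', t', h'⟩ := ih (j + 1) (by omega)
        ⟨Function.update (Function.update (Function.update σ₁.reg 41 1) x (j + 1))
          40 r, σ₁.mem⟩ (by rw [henv]; exact h₁) (by simp)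
      refine ⟨σ', _, .whileStep (by omega) (T' := T') e₂ ?_, ?_, h'⟩
      · convert e' using 3
        · simp [hx41, hx₁']
        · have h1 : (Function.update (Function.update σ₁.reg 41 1) (x : ℕ)
              (Function.update σ₁.reg 41 1 x + Function.update σ₁.reg 41 1 41)) b = N := by
            rw [← hbN]
            simp [Function.update_apply, hx41, hx₁']
          dsimp only
          rw [h1]
          simp [hx41, hx₁']
          omega
      · have : (r + 1) * (c.cost.eval L + 4) = r * (c.cost.eval L + 4) + (c.cost.eval L + 4) := by ring
        omega
  rintro σ rfl
  have henv : State.env ⟨Function.update (Function.update σ.reg x 0) 40 N, σ.mem⟩ = σ.env.set x 0 := by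
    ext y
    · have hy : (y : ℕ) ≠ 40 := by omega
      simp [State.env, Env.set, Function.update_apply, hy, Fin.ext_iff]
    · rfl
  have hbN : (Function.update σ.reg (x : ℕ) 0) b = N := by
    have := hb _ _ h0
    simpa only [Env.set, State.env, Function.update_apply, Fin.ext_iff] using this
  obtain ⟨σ', T', e', t', h'⟩ := key N 0 (by omega)
    ⟨Function.update (Function.update σ.reg x 0) 40 N, σ.mem⟩ (by rw [henv]; exact h0) (by simp)
  refine ⟨σ', _, .seq (.const x 0 σ) (.seq (.sub 40 b x _) (T' := T') ?_), ?_, hQ _ h'⟩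
  · convert e' using 3
    dsimp only
    rw [hbN]
    simp
  · have h1 : N * (c.cost.eval L + 4) ≤ L * (c.cost.eval L + 4) := Nat.mul_le_mul_right _ hN
    simp only [cost, Polynomial.eval_add, Polynomial.eval_mul, Polynomial.eval_X, Polynomial.eval_ofNat]
    omega

/-- A loop that collects the union of what its rounds contribute. -/
theorem Runs.loop_union {α : Type*} {x b : Fin 40} {c : Cmd} (P : Set α → Env → Prop) (D : ℕ → Set α)
    {N : ℕ} (hN : N ≤ L) (hb : ∀ S ε, P S ε → ε.reg b = N) (hx : ∀ S ε a, P S ε → P S (ε.set x a))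
    {S : Set α} (h0 : P S ε)
    (hc : ∀ j < N, ∀ S ε, P S ε → ε.reg x = j → Runs L c ε fun ε' => ε'.reg x = j ∧ P (S ∪ D j) ε') :
    Runs L (Cmd.loop x b c) ε (P (S ∪ {a | ∃ j < N, a ∈ D j})) := by
  refine Runs.loop (fun j ε => ε.reg x = j ∧ P (S ∪ {a | ∃ i < j, a ∈ D i}) ε) hN
    (fun _ _ h => hb _ _ h.2) ⟨by simp, hx _ _ _ (by simpa using h0)⟩ ?_ (fun ε h => h.2)
  rintro j hj ε ⟨h1, h2⟩
  refine (hc j hj _ _ h2 h1).mono fun ε' h => ⟨h.1, by simp, hx _ _ _ ?_⟩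
  convert h.2 using 1
  ext a
  simp only [Set.mem_union, Set.mem_ofPred_eq, Nat.lt_succ_iff_lt_or_eq, or_assoc]
  constructor
  · rintro (h | ⟨i, h | rfl, h'⟩)
    exacts [Or.inl h, Or.inr (Or.inl ⟨i, h, h'⟩), Or.inr (Or.inr h')]
  · rintro (h | ⟨i, h, h'⟩ | h)
    exacts [Or.inl h, Or.inr ⟨i, Or.inl h, h'⟩, Or.inr ⟨j, Or.inr rfl, h⟩]

end Cmd
end RAM

/-! ### The layout of the input in memory -/

namespace ColoredPath

theorem getElem?_flatMap_const {α β : Type*} (l : List α) (g : α → List β) {w i j : ℕ}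
    (hg : ∀ a ∈ l, (g a).length = w) (hi : i < l.length) (hj : j < w) :
    (l.flatMap g)[i * w + j]? = (g l[i])[j]? := by
  induction l generalizing i with
  | nil => simp at hi
  | cons a l ih =>
    have ha : (g a).length = w := hg a (by simp)
    cases i with
    | zero => simp [List.flatMap_cons, List.getElem?_append_left (ha.symm ▸ hj : j < (g a).length)]
    | succ i =>
      have : (i + 1) * w + j = (g a).length + (i * w + j) := by rw [ha]; ring
      rw [List.flatMap_cons, this, List.getElem?_append_right (by omega)]
      simpa using ih (fun b hb => hg b (by simp [hb])) (by simpa using hi)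

theorem getElem?_flatMap_offset {α β : Type*} (l : List α) (g : α → List β) {i j : ℕ}
    (hi : i < l.length) (hj : j < (g l[i]).length) :
    (l.flatMap g)[((l.take i).map fun a => (g a).length).sum + j]? = (g l[i])[j]? := by
  induction l generalizing i with
  | nil => simp at hi
  | cons a l ih =>
    cases i with
    | zero => simpa using List.getElem?_append_left (by simpa using hj)
    | succ i =>
      rw [List.flatMap_cons, List.take_succ_cons, List.map_cons, List.sum_cons, add_assoc,
        List.getElem?_append_right (by omega)]
      simpa using ih (by simpa using hi) (by simpa using hj)

theorem length_flatMap_const {α β : Type*} (l : List α) (g : α → List β) {w : ℕ}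
    (hg : ∀ a ∈ l, (g a).length = w) : (l.flatMap g).length = l.length * w := by
  induction l with
  | nil => simp
  | cons a l ih =>
    rw [List.flatMap_cons, List.length_append, hg a (by simp), ih fun b hb => hg b (by simp [hb])]
    simp; ring

namespace Instance

variable {n m : ℕ} (I : Instance n m)

/-- The first cell of the list of paths. -/
def pathBase (_ : Instance n m) : ℕ := 8 + n * n + n * m + n

/-- The first cell of path number `i`. -/
def pathAddr (i : ℕ) : ℕ := I.pathBase + ((I.paths.take i).map fun P => P.1.support.length + 1).sum

/-- Cell `a` of the input. -/
noncomputable def cell (a : ℕ) : ℕ := I.encode.getD a 0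

noncomputable def size : ℕ := I.encode.length

open Classical in
noncomputable def adjBlock : List ℕ :=
  (List.finRange n).flatMap fun i => (List.finRange n).map fun j => if I.G.Adj i j then 1 else 0

noncomputable def colorBlock : List ℕ :=
  (List.finRange n).flatMap fun i => (List.finRange m).map fun c => if c ∈ I.χ i then 1 else 0

noncomputable def forbiddenBlock : List ℕ := (List.finRange n).map fun i => if i ∈ I.U then 1 else 0

noncomputable def pathBlock : List ℕ :=
  I.paths.flatMap fun P => P.1.support.length :: P.1.support.map Fin.val

theorem encode_eq : I.encode =
    [n, m, I.s.val, I.t.val, I.v.val, I.k, I.b, I.paths.length] ++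
      (I.adjBlock ++ (I.colorBlock ++ (I.forbiddenBlock ++ I.pathBlock))) := by
  simp only [encode, adjBlock, colorBlock, forbiddenBlock, pathBlock, List.append_assoc]

theorem length_adjBlock : I.adjBlock.length = n * n := by
  rw [adjBlock, length_flatMap_const _ _ (w := n) (by simp), List.length_finRange]

theorem length_colorBlock : I.colorBlock.length = n * m := by
  rw [colorBlock, length_flatMap_const _ _ (w := m) (by simp), List.length_finRange]

theorem length_forbiddenBlock : I.forbiddenBlock.length = n := by simp [forbiddenBlock]

theorem size_eq : I.size = I.pathBase + I.pathBlock.length := by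
  simp [size, encode_eq, length_adjBlock, length_colorBlock, length_forbiddenBlock, pathBase]
  ring

theorem cell_header (a : ℕ) (h : a < 8) :
    I.cell a = [n, m, I.s.val, I.t.val, I.v.val, I.k, I.b, I.paths.length].getD a 0 := by
  rw [cell, encode_eq, List.getD_append _ _ _ _ (by simpa using h)]

theorem cell_eq_of_getElem? {p r : List ℕ} {q : List ℕ} {a x : ℕ} (h : I.encode = p ++ (q ++ r))
    (hx : q[a]? = some x) : I.cell (p.length + a) = x := by
  have ha : a < q.length := (List.getElem?_eq_some_iff.1 hx).1
  rw [cell, h, List.getD_eq_getElem?_getD, List.getElem?_append_right (by omega),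
    Nat.add_sub_cancel_left, List.getElem?_append_left ha, hx]
  rfl

open Classical in
theorem cell_adj (a b : Fin n) : I.cell (8 + (a * n + b)) = if I.G.Adj a b then 1 else 0 := by
  refine I.cell_eq_of_getElem? (p := [n, m, I.s.val, I.t.val, I.v.val, I.k, I.b, I.paths.length])
    I.encode_eq ?_
  rw [adjBlock, getElem?_flatMap_const _ _ (w := n) (by simp) (by simp) b.2]
  simp

theorem cell_color (a : Fin n) (c : Fin m) :
    I.cell (8 + n * n + (a * m + c)) = if c ∈ I.χ a then 1 else 0 := by
  have := I.cell_eq_of_getElem? (p := [n, m, I.s.val, I.t.val, I.v.val, I.k, I.b, I.paths.length] ++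
    I.adjBlock) (q := I.colorBlock) (a := a * m + c) (x := if c ∈ I.χ a then 1 else 0)
    (r := I.forbiddenBlock ++ I.pathBlock) (by rw [encode_eq]; simp) (by
      rw [colorBlock, getElem?_flatMap_const _ _ (w := m) (by simp) (by simp) c.2]
      simp)
  rw [← this]
  congr 1
  simp [length_adjBlock]
  ring

theorem cell_forbidden (a : Fin n) :
    I.cell (8 + n * n + n * m + a) = if a ∈ I.U then 1 else 0 := by
  have := I.cell_eq_of_getElem? (p := [n, m, I.s.val, I.t.val, I.v.val, I.k, I.b, I.paths.length] ++
    (I.adjBlock ++ I.colorBlock)) (q := I.forbiddenBlock) (a := a) (x := if a ∈ I.U then 1 else 0)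
    (r := I.pathBlock) (by rw [encode_eq]; simp) (by simp [forbiddenBlock])
  rw [← this]
  congr 1
  simp [length_adjBlock, length_colorBlock]
  ring

theorem cell_path {i j x : ℕ} (hi : i < I.paths.length)
    (h : (I.paths[i].1.support.length :: I.paths[i].1.support.map Fin.val)[j]? = some x) :
    I.cell (I.pathAddr i + j) = x := by
  have hj := (List.getElem?_eq_some_iff.1 h).1
  have := I.cell_eq_of_getElem? (p := [n, m, I.s.val, I.t.val, I.v.val, I.k, I.b, I.paths.length] ++
    (I.adjBlock ++ (I.colorBlock ++ I.forbiddenBlock))) (q := I.pathBlock) (r := [])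
    (a := ((I.paths.take i).map fun P => P.1.support.length + 1).sum + j) (x := x)
    (by rw [encode_eq]; simp) (by
      rw [pathBlock, ← h, ← getElem?_flatMap_offset I.paths
        (fun P => P.1.support.length :: P.1.support.map Fin.val) hi hj]
      simp)
  rw [← this, pathAddr, pathBase]
  congr 1
  simp [length_adjBlock, length_colorBlock, length_forbiddenBlock]
  ring

theorem cell_path_length {i : ℕ} (hi : i < I.paths.length) :
    I.cell (I.pathAddr i) = I.paths[i].1.support.length :=
  I.cell_path (j := 0) hi (by simp)

theorem cell_path_vertex {i j : ℕ} (hi : i < I.paths.length) (hj : j < I.paths[i].1.support.length) :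
    I.cell (I.pathAddr i + 1 + j) = I.paths[i].1.support[j] := by
  rw [add_assoc]
  exact I.cell_path hi (by
    rw [add_comm 1 j, List.getElem?_cons_succ, List.getElem?_map, List.getElem?_eq_getElem hj]
    rfl)

theorem pathAddr_succ {i : ℕ} (hi : i < I.paths.length) :
    I.pathAddr (i + 1) = I.pathAddr i + 1 + I.paths[i].1.support.length := by
  rw [pathAddr, pathAddr, List.take_succ_eq_append_getElem hi, List.map_append, List.sum_append]
  simp
  ring

theorem pathAddr_le (i : ℕ) : I.pathAddr i ≤ I.size := by
  have h : I.pathBlock.length = (I.paths.map fun P => P.1.support.length + 1).sum := by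
    simp [pathBlock, List.length_flatMap]
  rw [size_eq, h, pathAddr]
  refine Nat.add_le_add_left ?_ _
  conv_rhs => rw [← List.take_append_drop i I.paths, List.map_append, List.sum_append]
  omega

theorem pathAddr_length : I.paths.length ≤ I.pathAddr I.paths.length := by
  have : ∀ i ≤ I.paths.length, i ≤ I.pathAddr i := by
    intro i
    induction i with
    | zero => simp
    | succ i ih =>
      intro hi
      rw [I.pathAddr_succ hi]
      have := ih (by omega)
      omega
  exact this _ le_rfl

end Instance
end ColoredPath

/-! ### The rounds of the search on the machine -/

namespace ColoredPath
namespace Instance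

open RAM RAM.Expr RAM.Cmd

variable {n m : ℕ} (I : Instance n m)

/-- The registers and the memory as they are during the search: registers 0 to 11 hold the parameters
and the addresses of the tables, and the input is intact. -/
structure Ctx (ε : Env) : Prop where
  reg0 : ε.reg 0 = I.size
  reg1 : ε.reg 1 = n
  reg2 : ε.reg 2 = m
  reg3 : ε.reg 3 = I.s
  reg4 : ε.reg 4 = I.t
  reg5 : ε.reg 5 = I.v
  reg6 : ε.reg 6 = I.k
  reg7 : ε.reg 7 = I.paths.length
  reg8 : ε.reg 8 = 8 + n * n
  reg9 : ε.reg 9 = 8 + n * n + n * m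
  reg10 : ε.reg 10 = I.size + m
  reg11 : ε.reg 11 = I.size + m + n
  input : ∀ a < I.size, ε.mem a = I.cell a

variable {I} {ε : Env}

theorem Ctx.set (h : I.Ctx ε) {x : Fin 40} (hx : 12 ≤ x) (a : ℕ) : I.Ctx (ε.set x a) := by
  have hne : ∀ y : Fin 40, y < 12 → (ε.set x a).reg y = ε.reg y := fun y hy =>
    Env.set_reg_of_ne _ _ (by omega)
  constructor <;> first
    | (rw [hne _ (by decide)]; first
        | exact h.reg0 | exact h.reg1 | exact h.reg2 | exact h.reg3 | exact h.reg4 | exact h.reg5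
        | exact h.reg6 | exact h.reg7 | exact h.reg8 | exact h.reg9 | exact h.reg10 | exact h.reg11)
    | exact h.input

theorem Ctx.write (h : I.Ctx ε) {i : ℕ} (hi : I.size ≤ i) (a : ℕ) : I.Ctx (ε.write i a) :=
  { h with
    input := fun b hb => by rw [Env.write_mem, if_neg (by omega)]; exact h.input b hb }

theorem lt_size_of_lt_pathBase {a : ℕ} (h : a < I.pathBase) : a < I.size := by
  rw [size_eq]; omega

theorem mul_add_lt {a b p q : ℕ} (ha : a < p) (hb : b < q) : a * q + b < p * q :=
  calc a * q + b < (a + 1) * q := by rw [add_mul, one_mul]; omega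
    _ ≤ p * q := Nat.mul_le_mul_right _ ha

theorem n_le_size : n ≤ I.size := by rw [size_eq, pathBase]; omega

theorem m_le_size : m ≤ I.size := by
  have hn : 0 < n := I.s.pos
  rw [size_eq, pathBase]
  have : m ≤ n * m := Nat.le_mul_of_pos_left _ hn
  omega

theorem length_le_size : I.paths.length ≤ I.size := I.pathAddr_length.trans (I.pathAddr_le _)

theorem one_le_size : 1 ≤ I.size := by rw [size_eq, pathBase]; omega

/-- The test of equality. -/
def eqTest (a b : Expr) : Expr := .sub (.lit 1) (.add (.sub a b) (.sub b a))

theorem eval_eqTest (a b : Expr) : (eqTest a b).eval ε ≠ 0 ↔ a.eval ε = b.eval ε := by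
  simp only [eqTest, Expr.eval]; omega

/-- Whether colour `y` is on vertex `x`. -/
def colorAt (x y : Expr) : Expr := .rd (.add (.var 8) (.add (.mul x (.var 2)) y))

/-- Whether the vertices in registers `x` and `y` are adjacent. -/
def adjAt (x y : Fin 40) : Expr := .rd (.add (.lit 8) (.add (.mul (.var x) (.var 1)) (.var y)))

theorem Ctx.eval_colorAt (h : I.Ctx ε) {x y : Expr} {a : Fin n} {c : Fin m} (hx : x.eval ε = a)
    (hy : y.eval ε = c) : (colorAt x y).eval ε = if c ∈ I.χ a then 1 else 0 := by
  have hlt := mul_add_lt a.2 c.2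
  simp only [colorAt, Expr.eval, hx, hy, h.reg8, h.reg2]
  rw [h.input _ (lt_size_of_lt_pathBase (by rw [pathBase]; omega)), cell_color]

theorem bounded_colorAt {x y : Expr} {L : ℕ} (hx : x.Bounded L ε) (hy : y.Bounded L ε)
    (hxL : x.eval ε ≤ L) : (colorAt x y).Bounded L ε := ⟨trivial, ⟨hx, trivial, hxL⟩, hy⟩

open Classical in
theorem Ctx.eval_adjAt (h : I.Ctx ε) {x y : Fin 40} {a b : Fin n} (hx : ε.reg x = a)
    (hy : ε.reg y = b) : (adjAt x y).eval ε = if I.G.Adj a b then 1 else 0 := by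
  have hlt := mul_add_lt a.2 b.2
  simp only [adjAt, Expr.eval, hx, hy, h.reg1]
  rw [h.input _ (lt_size_of_lt_pathBase (by rw [pathBase]; omega)), cell_adj]

theorem bounded_adjAt {x y : Fin 40} {L : ℕ} (hxL : ε.reg x ≤ L) : (adjAt x y).Bounded L ε :=
  ⟨trivial, ⟨trivial, trivial, hxL⟩, trivial⟩

/-- The tables: the marked colours `M`, the found vertices `F`, and the vertices that may be used. -/
structure Tables (I : Instance n m) (M F : Set ℕ) (ε : Env) : Prop extends I.Ctx ε where
  mark : ∀ c < m, ε.mem (I.size + c) ≠ 0 ↔ c ∈ M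
  found : ∀ w < n, ε.mem (I.size + m + w) ≠ 0 ↔ w ∈ F
  usable : ∀ w : Fin n, ε.mem (I.size + m + n + w) = 0 ↔ I.χ w = ∅ ∧ I.Allowed w

variable {M F : Set ℕ}

theorem Tables.set (h : I.Tables M F ε) {x : Fin 40} (hx : 12 ≤ x) (a : ℕ) :
    I.Tables M F (ε.set x a) :=
  { h with toCtx := h.toCtx.set hx a }

theorem Tables.write_mark (h : I.Tables M F ε) {c : ℕ} (hc : c < m) :
    I.Tables (M ∪ {c}) F (ε.write (I.size + c) 1) where
  toCtx := h.toCtx.write (by omega) _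
  mark := fun d hd => by
    rw [Env.write_mem]
    split_ifs with he
    · simp [(by omega : d = c)]
    · rw [h.mark d hd]
      have hne : d ≠ c := by rintro rfl; exact he rfl
      simp [hne]
  found := fun w hw => by rw [Env.write_mem, if_neg (by omega)]; exact h.found w hw
  usable := fun w => by rw [Env.write_mem, if_neg (by omega)]; exact h.usable w

theorem Tables.write_found (h : I.Tables M F ε) {y : ℕ} (hy : y < n) :
    I.Tables M (F ∪ {y}) (ε.write (I.size + m + y) 1) where
  toCtx := h.toCtx.write (by omega) _
  mark := fun d hd => by rw [Env.write_mem, if_neg (by omega)]; exact h.mark d hd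
  found := fun w hw => by
    rw [Env.write_mem]
    split_ifs with he
    · simp [(by omega : w = y)]
    · rw [h.found w hw]
      have hne : w ≠ y := by rintro rfl; exact he rfl
      simp [hne]
  usable := fun w => by rw [Env.write_mem, if_neg (by omega)]; exact h.usable w

/-- Mark the colours on the found vertices and their neighbours. -/
def markCmd : Cmd :=
  .loop 14 1 (.loop 15 1 (.loop 16 2 (.cond (.rd (.add (.var 10) (.var 14)))
    (.cond (.add (eqTest (.var 14) (.var 15)) (adjAt 14 15))
      (.cond (colorAt (.var 15) (.var 16)) (.write (.add (.var 0) (.var 16)) (.lit 1)))))))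

/-- Find the vertices with marked colours and the usable neighbours of such vertices. -/
def findCmd : Cmd :=
  .loop 16 2 (.loop 14 1 (.loop 15 1 (.cond (.rd (.add (.var 0) (.var 16)))
    (.cond (colorAt (.var 14) (.var 16))
      (.cond (.add (eqTest (.var 14) (.var 15))
          (.mul (adjAt 14 15) (.sub (.lit 1) (.rd (.add (.var 11) (.var 15))))))
        (.write (.add (.var 10) (.var 15)) (.lit 1)))))))

/-- The numbers of the elements of `Fin n` with a given property. -/
def natSet {n : ℕ} (p : Fin n → Prop) : Set ℕ := {x | ∃ h : x < n, p ⟨x, h⟩}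

/-- This half round reads the found vertices and writes only marks, so the set that it reads stays
fixed while the marks grow. Register 17 is carried along because it counts the rounds of the
enclosing loop. -/
theorem runs_markCmd (p : Fin n → Prop) (r : ℕ) (h : I.Tables M (natSet p) ε) (hr : ε.reg 17 = r) :
    Runs I.size markCmd ε fun ε' => I.Tables (M ∪ natSet fun c =>
      ∃ a b, p a ∧ (a = b ∨ I.G.Adj a b) ∧ c ∈ I.χ b) (natSet p) ε' ∧ ε'.reg 17 = r := by
  -- The contribution of one innermost round: the singleton of `c`, or nothing.
  let D : ℕ → ℕ → ℕ → Set ℕ := fun a b c => {x | x = c ∧ ∃ (ha : a < n) (hb : b < n) (hc : c < m),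
    p ⟨a, ha⟩ ∧ ((⟨a, ha⟩ : Fin n) = ⟨b, hb⟩ ∨ I.G.Adj ⟨a, ha⟩ ⟨b, hb⟩) ∧ ⟨c, hc⟩ ∈ I.χ ⟨b, hb⟩}
  have hmain : Runs I.size markCmd ε fun ε' => I.Tables (M ∪ {x | ∃ a < n, x ∈ {x | ∃ b < n,
      x ∈ {x | ∃ c < m, x ∈ D a b c}}}) (natSet p) ε' ∧ ε'.reg 17 = r := by
    refine Runs.loop_union (fun S ε => I.Tables S (natSet p) ε ∧ ε.reg 17 = r) _ n_le_size
      (fun S ε h => h.1.reg1) (fun S ε a h => ⟨h.1.set (by decide) a, by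
        rw [Env.set_reg_of_ne _ _ (by decide)]; exact h.2⟩) ⟨h, hr⟩ ?_
    intro a ha S ε h hxa
    refine (Runs.loop_union (fun S ε => (I.Tables S (natSet p) ε ∧ ε.reg 17 = r) ∧ ε.reg 14 = a)
      _ n_le_size (fun S ε h => h.1.1.reg1) (fun S ε a h => ⟨⟨h.1.1.set (by decide) a, by
        rw [Env.set_reg_of_ne _ _ (by decide)]; exact h.1.2⟩, by
        rw [Env.set_reg_of_ne _ _ (by decide)]; exact h.2⟩) ⟨h, hxa⟩ ?_).mono fun ε h => ⟨h.2, h.1⟩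
    intro b hb S ε h hxb
    refine (Runs.loop_union (fun S ε => ((I.Tables S (natSet p) ε ∧ ε.reg 17 = r) ∧ ε.reg 14 = a) ∧
      ε.reg 15 = b) (D a b) m_le_size (fun S ε h => h.1.1.1.reg2) (fun S ε a h =>
        ⟨⟨⟨h.1.1.1.set (by decide) a, by
        rw [Env.set_reg_of_ne _ _ (by decide)]; exact h.1.1.2⟩, by
        rw [Env.set_reg_of_ne _ _ (by decide)]; exact h.1.2⟩, by
        rw [Env.set_reg_of_ne _ _ (by decide)]; exact h.2⟩) ⟨h, hxb⟩ ?_).mono fun ε h => ⟨h.2, h.1⟩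
    rintro c hc S ε ⟨⟨⟨h, hr⟩, hxa⟩, hxb⟩ hxc
    have hskip : (∀ x, x ∉ D a b c) → ε.reg 16 = c ∧
        ((I.Tables (S ∪ D a b c) (natSet p) ε ∧ ε.reg 17 = r) ∧ ε.reg 14 = a) ∧ ε.reg 15 = b := by
      intro hD
      rw [Set.eq_empty_of_forall_notMem hD, Set.union_empty]
      exact ⟨hxc, ⟨⟨h, hr⟩, hxa⟩, hxb⟩
    have hfa : (Expr.rd (.add (.var 10) (.var 14))).eval ε ≠ 0 ↔ p ⟨a, ha⟩ := by
      simp only [Expr.eval, h.reg10, hxa]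
      rw [h.found a ha]
      exact ⟨fun ⟨_, h⟩ => h, fun h => ⟨ha, h⟩⟩
    have hadj : (Expr.add (eqTest (.var 14) (.var 15)) (adjAt 14 15)).eval ε ≠ 0 ↔
        ((⟨a, ha⟩ : Fin n) = ⟨b, hb⟩ ∨ I.G.Adj ⟨a, ha⟩ ⟨b, hb⟩) := by
      have h1 := eval_eqTest (ε := ε) (.var 14) (.var 15)
      have h2 := h.eval_adjAt (a := ⟨a, ha⟩) (b := ⟨b, hb⟩) hxa hxb
      simp only [Expr.eval, hxa, hxb] at h1
      rw [Expr.eval, h2, Ne, Nat.add_eq_zero_iff, not_and_or, ← Ne, h1]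
      simp
    have hcol : (colorAt (.var 15) (.var 16)).eval ε ≠ 0 ↔ (⟨c, hc⟩ : Fin m) ∈ I.χ ⟨b, hb⟩ := by
      rw [h.eval_colorAt (x := .var 15) (y := .var 16) (a := ⟨b, hb⟩) (c := ⟨c, hc⟩) hxb hxc]
      simp
    have hbL : ε.reg 15 ≤ I.size := by rw [hxb]; exact hb.le.trans n_le_size
    have haL : ε.reg 14 ≤ I.size := by rw [hxa]; exact ha.le.trans n_le_size
    refine Runs.cond ⟨trivial, trivial⟩ (fun h1 => ?_) fun h1 => hskip ?_
    · refine Runs.cond ⟨⟨trivial, ⟨trivial, trivial⟩, ⟨trivial, trivial⟩⟩, bounded_adjAt haL⟩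
        (fun h2 => ?_) fun h2 => hskip ?_
      · refine Runs.cond (bounded_colorAt trivial trivial hbL) (fun h3 => ?_) fun h3 => hskip ?_
        · refine Runs.write ⟨trivial, trivial⟩ trivial ⟨hxc, ⟨⟨?_, hr⟩, hxa⟩, hxb⟩
          have hD : D a b c = {c} := by
            ext x
            simp only [D, Set.mem_ofPred_eq, Set.mem_singleton_iff, and_iff_left_iff_imp]
            exact fun _ => ⟨ha, hb, hc, hfa.1 h1, hadj.1 h2, hcol.1 h3⟩
          rw [hD]
          simp only [Expr.eval, h.reg0, hxc]
          exact h.write_mark hc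
        · rintro x ⟨-, _, _, _, -, -, h'⟩
          exact hcol.2 h' h3
      · rintro x ⟨-, _, _, _, -, h', -⟩
        exact hadj.2 h' h2
    · rintro x ⟨-, _, _, _, h', -⟩
      exact hfa.2 h' h1
  refine hmain.mono fun ε' h => ?_
  convert h using 3
  ext x
  simp only [D, natSet, Set.mem_ofPred_eq]
  constructor
  · rintro ⟨hx, a, b, h1, h2, h3⟩
    exact ⟨a, a.2, b, b.2, x, hx, rfl, a.2, b.2, hx, h1, h2, h3⟩
  · rintro ⟨a, ha, b, hb, c, hc, rfl, _, _, _, h1, h2, h3⟩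
    exact ⟨hc, ⟨a, ha⟩, ⟨b, hb⟩, h1, h2, h3⟩

theorem runs_findCmd (q : Fin m → Prop) (r : ℕ) (h : I.Tables (natSet q) F ε) (hr : ε.reg 17 = r) :
    Runs I.size findCmd ε fun ε' => I.Tables (natSet q) (F ∪ natSet fun b =>
      ∃ c a, q c ∧ c ∈ I.χ a ∧ (a = b ∨ I.G.Adj a b ∧ I.χ b = ∅ ∧ I.Allowed b)) ε' ∧
        ε'.reg 17 = r := by
  let D : ℕ → ℕ → ℕ → Set ℕ := fun c a b => {x | x = b ∧ ∃ (hc : c < m) (ha : a < n) (hb : b < n),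
    q ⟨c, hc⟩ ∧ ⟨c, hc⟩ ∈ I.χ ⟨a, ha⟩ ∧ ((⟨a, ha⟩ : Fin n) = ⟨b, hb⟩ ∨
      I.G.Adj ⟨a, ha⟩ ⟨b, hb⟩ ∧ I.χ ⟨b, hb⟩ = ∅ ∧ I.Allowed ⟨b, hb⟩)}
  have hmain : Runs I.size findCmd ε fun ε' => I.Tables (natSet q) (F ∪ {x | ∃ c < m, x ∈
      {x | ∃ a < n, x ∈ {x | ∃ b < n, x ∈ D c a b}}}) ε' ∧ ε'.reg 17 = r := by
    refine Runs.loop_union (fun S ε => I.Tables (natSet q) S ε ∧ ε.reg 17 = r) _ m_le_size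
      (fun S ε h => h.1.reg2) (fun S ε a h => ⟨h.1.set (by decide) a, by
        rw [Env.set_reg_of_ne _ _ (by decide)]; exact h.2⟩) ⟨h, hr⟩ ?_
    intro c hc S ε h hxc
    refine (Runs.loop_union (fun S ε => (I.Tables (natSet q) S ε ∧ ε.reg 17 = r) ∧ ε.reg 16 = c)
      _ n_le_size (fun S ε h => h.1.1.reg1) (fun S ε a h => ⟨⟨h.1.1.set (by decide) a, by
        rw [Env.set_reg_of_ne _ _ (by decide)]; exact h.1.2⟩, by
        rw [Env.set_reg_of_ne _ _ (by decide)]; exact h.2⟩) ⟨h, hxc⟩ ?_).mono fun ε h => ⟨h.2, h.1⟩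
    intro a ha S ε h hxa
    refine (Runs.loop_union (fun S ε => ((I.Tables (natSet q) S ε ∧ ε.reg 17 = r) ∧ ε.reg 16 = c) ∧
      ε.reg 14 = a) (D c a) n_le_size (fun S ε h => h.1.1.1.reg1) (fun S ε a h =>
        ⟨⟨⟨h.1.1.1.set (by decide) a, by
        rw [Env.set_reg_of_ne _ _ (by decide)]; exact h.1.1.2⟩, by
        rw [Env.set_reg_of_ne _ _ (by decide)]; exact h.1.2⟩, by
        rw [Env.set_reg_of_ne _ _ (by decide)]; exact h.2⟩) ⟨h, hxa⟩ ?_).mono fun ε h => ⟨h.2, h.1⟩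
    rintro b hb S ε ⟨⟨⟨h, hr⟩, hxc⟩, hxa⟩ hxb
    have hskip : (∀ x, x ∉ D c a b) → ε.reg 15 = b ∧
        ((I.Tables (natSet q) (S ∪ D c a b) ε ∧ ε.reg 17 = r) ∧ ε.reg 16 = c) ∧ ε.reg 14 = a := by
      intro hD
      rw [Set.eq_empty_of_forall_notMem hD, Set.union_empty]
      exact ⟨hxb, ⟨⟨h, hr⟩, hxc⟩, hxa⟩
    have hqc : (Expr.rd (.add (.var 0) (.var 16))).eval ε ≠ 0 ↔ q ⟨c, hc⟩ := by
      simp only [Expr.eval, h.reg0, hxc]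
      rw [h.mark c hc]
      exact ⟨fun ⟨_, h⟩ => h, fun h => ⟨hc, h⟩⟩
    classical
    have hadjv := h.eval_adjAt (a := ⟨a, ha⟩) (b := ⟨b, hb⟩) hxa hxb
    have hadj : (Expr.add (eqTest (.var 14) (.var 15))
        (.mul (adjAt 14 15) (.sub (.lit 1) (.rd (.add (.var 11) (.var 15)))))).eval ε ≠ 0 ↔
        ((⟨a, ha⟩ : Fin n) = ⟨b, hb⟩ ∨
          I.G.Adj ⟨a, ha⟩ ⟨b, hb⟩ ∧ I.χ ⟨b, hb⟩ = ∅ ∧ I.Allowed ⟨b, hb⟩) := by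
      have h1 := eval_eqTest (ε := ε) (.var 14) (.var 15)
      have h3 : (Expr.sub (.lit 1) (.rd (.add (.var 11) (.var 15)))).eval ε ≠ 0 ↔
          I.χ ⟨b, hb⟩ = ∅ ∧ I.Allowed ⟨b, hb⟩ := by
        rw [← h.usable ⟨b, hb⟩]
        simp only [Expr.eval, h.reg11, hxb]
        omega
      have hmul : (Expr.mul (adjAt 14 15) (.sub (.lit 1) (.rd (.add (.var 11) (.var 15))))).eval ε =
        (adjAt 14 15).eval ε * (Expr.sub (.lit 1) (.rd (.add (.var 11) (.var 15)))).eval ε := rfl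
      rw [Expr.eval, Ne, Nat.add_eq_zero_iff, not_and_or, ← Ne, h1, hmul, mul_eq_zero, not_or,
        ← Ne, ← Ne, h3, hadjv]
      simp [Expr.eval, hxa, hxb]
    have hcol : (colorAt (.var 14) (.var 16)).eval ε ≠ 0 ↔ (⟨c, hc⟩ : Fin m) ∈ I.χ ⟨a, ha⟩ := by
      rw [h.eval_colorAt (x := .var 14) (y := .var 16) (a := ⟨a, ha⟩) (c := ⟨c, hc⟩) hxa hxc]
      simp
    have haL : ε.reg 14 ≤ I.size := by rw [hxa]; exact ha.le.trans n_le_size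
    -- The product serves as a conjunction, but its left factor still has to be bounded for the
    -- running time.
    have hadjL : (adjAt 14 15).eval ε ≤ I.size := by
      rw [hadjv]
      split_ifs
      exacts [one_le_size, Nat.zero_le _]
    refine Runs.cond ⟨trivial, trivial⟩ (fun h1 => ?_) fun h1 => hskip ?_
    · refine Runs.cond (bounded_colorAt trivial trivial haL) (fun h2 => ?_) fun h2 => hskip ?_
      · refine Runs.cond ⟨⟨trivial, ⟨trivial, trivial⟩, ⟨trivial, trivial⟩⟩, bounded_adjAt haL,
          ⟨trivial, trivial, trivial⟩, hadjL⟩ (fun h3 => ?_) fun h3 => hskip ?_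
        · refine Runs.write ⟨trivial, trivial⟩ trivial ⟨hxb, ⟨⟨?_, hr⟩, hxc⟩, hxa⟩
          have hD : D c a b = {b} := by
            ext x
            simp only [D, Set.mem_ofPred_eq, Set.mem_singleton_iff, and_iff_left_iff_imp]
            exact fun _ => ⟨hc, ha, hb, hqc.1 h1, hcol.1 h2, hadj.1 h3⟩
          rw [hD]
          simp only [Expr.eval, h.reg10, hxb]
          exact h.write_found hb
        · rintro x ⟨-, _, _, _, -, -, h'⟩
          exact hadj.2 h' h3
      · rintro x ⟨-, _, _, _, -, h', -⟩
        exact hcol.2 h' h2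
    · rintro x ⟨-, _, _, _, h', -⟩
      exact hqc.2 h' h1
  refine hmain.mono fun ε' h => ?_
  convert h using 3
  ext x
  simp only [D, natSet, Set.mem_ofPred_eq]
  constructor
  · rintro ⟨hx, c, a, h1, h2, h3⟩
    exact ⟨c, c.2, a, a.2, x, hx, rfl, c.2, a.2, hx, h1, h2, h3⟩
  · rintro ⟨c, hc, a, ha, b, hb, rfl, _, _, _, h1, h2, h3⟩
    exact ⟨hb, ⟨c, hc⟩, ⟨a, ha⟩, h1, h2, h3⟩

/-- Repeat for `k` rounds. -/
def roundsCmd : Cmd := .loop 17 6 (.seq markCmd findCmd)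

theorem runs_roundsCmd (hk : I.k ≤ I.size) (h : I.Tables ∅ {↑I.t} ε) :
    Runs I.size roundsCmd ε fun ε' => ∃ F, I.Tables
      (natSet fun c => ∃ j < I.k, marked I.G I.χ I.Allowed I.t j c) F ε' := by
  refine Runs.loop (fun j ε => ε.reg 17 = j ∧ I.Tables
    (natSet fun c => ∃ i < j, marked I.G I.χ I.Allowed I.t i c)
    (natSet (front I.G I.χ I.Allowed I.t j)) ε) hk (fun _ _ h => h.2.reg6) ⟨by simp, ?_⟩ ?_
    fun ε h => ⟨_, h.2⟩
  · convert h.set (x := 17) (by decide) 0 using 1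
    · ext x; simp [natSet]
    · ext x
      simp only [natSet, front, Set.mem_ofPred_eq, Set.mem_singleton_iff]
      exact ⟨fun ⟨_, h⟩ => congrArg Fin.val h, fun h => ⟨h ▸ I.t.2, Fin.ext h⟩⟩
  · rintro j hj ε ⟨hr, h⟩
    refine Runs.seq ((runs_markCmd _ j h hr).mono fun ε₁ h₁ => ?_)
    have hM : (natSet fun c => ∃ i < j, marked I.G I.χ I.Allowed I.t i c) ∪ (natSet fun c =>
        ∃ a b, front I.G I.χ I.Allowed I.t j a ∧ (a = b ∨ I.G.Adj a b) ∧ c ∈ I.χ b) =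
        natSet fun c => ∃ i < j + 1, marked I.G I.χ I.Allowed I.t i c := by
      ext x
      simp only [natSet, Set.mem_union, Set.mem_ofPred_eq, Nat.lt_succ_iff_lt_or_eq]
      constructor
      · rintro (⟨hx, i, hi, h'⟩ | ⟨hx, h'⟩)
        exacts [⟨hx, i, Or.inl hi, h'⟩, ⟨hx, j, Or.inr rfl, h'⟩]
      · rintro ⟨hx, i, hi | rfl, h'⟩
        exacts [Or.inl ⟨hx, i, hi, h'⟩, Or.inr ⟨hx, h'⟩]
    rw [hM] at h₁
    refine (runs_findCmd _ j h₁.1 h₁.2).mono fun ε₂ h₂ => ⟨h₂.2, by simp, ?_⟩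
    convert h₂.1.set (x := 17) (by decide) (j + 1) using 1
    ext x
    simp only [natSet, Set.mem_union, Set.mem_ofPred_eq, front_succ_iff, ← exists_or]
    -- The machine uses all colours marked so far, `front` only those of index `j`; by monotonicity
    -- these are the same.
    refine exists_congr fun hx => or_congr_right ⟨?_, ?_⟩
    · rintro ⟨c, w, hc, h⟩
      exact ⟨c, w, ⟨j, by omega, hc⟩, h⟩
    · rintro ⟨c, w, ⟨i, hi, hc⟩, h⟩
      exact ⟨c, w, marked_mono (by omega) hc, h⟩

end Instance
end ColoredPath

/-! ### Setup, output and correctness of the algorithm -/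

namespace ColoredPath
namespace Instance

open RAM RAM.Expr RAM.Cmd

variable {n m : ℕ} {I : Instance n m} {ε : Env} {M F : Set ℕ}

/-- Read the parameters and compute the addresses of the tables. -/
def setupCmd : Cmd :=
  .seq (.assign 1 (.rd (.lit 0))) <| .seq (.assign 2 (.rd (.lit 1))) <|
  .seq (.assign 3 (.rd (.lit 2))) <| .seq (.assign 4 (.rd (.lit 3))) <|
  .seq (.assign 5 (.rd (.lit 4))) <| .seq (.assign 6 (.rd (.lit 5))) <|
  -- Cell 6 holds `b`, which serves only to prove that a suitable path exists; the search does not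
  -- need it.
  .seq (.assign 7 (.rd (.lit 7))) <| .seq (.assign 8 (.add (.lit 8) (.mul (.var 1) (.var 1)))) <|
  .seq (.assign 9 (.add (.var 8) (.mul (.var 1) (.var 2)))) <|
  .seq (.assign 10 (.add (.var 0) (.var 2))) (.assign 11 (.add (.var 10) (.var 1)))

theorem runs_setupCmd (h0 : ε.reg 0 = I.size) (hm : ε.mem = I.cell) :
    Runs I.size setupCmd ε fun ε' => I.Ctx ε' ∧ ε'.mem = I.cell := by
  have hn : I.cell 0 ≤ I.size := by rw [cell_header _ _ (by omega)]; exact n_le_size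
  refine Runs.seq (.assign trivial <| .seq <| .assign trivial <| .seq <| .assign trivial <|
    .seq <| .assign trivial <| .seq <| .assign trivial <| .seq <| .assign trivial <|
    .seq <| .assign trivial <| .seq <| .assign ⟨trivial, trivial, trivial, ?_⟩ <|
    .seq <| .assign ⟨trivial, trivial, trivial, ?_⟩ <| .seq <| .assign ⟨trivial, trivial⟩ <|
    .assign ⟨trivial, trivial⟩ ⟨⟨?_, ?_, ?_, ?_, ?_, ?_, ?_, ?_, ?_, ?_, ?_, ?_, ?_⟩, ?_⟩)
  · simpa [Expr.eval, Env.set_reg, hm] using hn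
  · simpa [Expr.eval, Env.set_reg, hm] using hn
  all_goals simp [Expr.eval, Env.set_reg, hm, h0, cell_header]

/-- Compute the table of the vertices that may be used. -/
def usableCmd : Cmd :=
  .loop 14 1 (.seq (.assign 18 (.add (.rd (.add (.var 9) (.var 14)))
      (.add (eqTest (.var 14) (.var 3)) (eqTest (.var 14) (.var 5)))))
    (.seq (.loop 16 2 (.assign 18 (.add (.var 18) (colorAt (.var 14) (.var 16)))))
      (.write (.add (.var 11) (.var 14)) (.var 18))))

/-- Memory behind the input is zero, so the tables of marks and of found vertices start out empty.
Register 18 adds up the indicators of membership in `U`, of equality with `s` and `v`, and of every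
colour; the sum vanishes exactly at the usable vertices. -/
theorem runs_usableCmd (h : I.Ctx ε) (hm : ε.mem = I.cell) :
    Runs I.size usableCmd ε fun ε' => I.Tables ∅ ∅ ε' := by
  refine Runs.loop (fun j ε => ε.reg 14 = j ∧ I.Ctx ε ∧ (∀ a < m + n, ε.mem (I.size + a) = 0) ∧
    ∀ w : Fin n, w < j → (ε.mem (I.size + m + n + w) = 0 ↔ I.χ w = ∅ ∧ I.Allowed w)) n_le_size
    (fun _ _ h => h.2.1.reg1) ⟨by simp, h.set (by decide) 0, fun a ha => ?_, by simp⟩ ?_ ?_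
  · simp [hm, cell, size]
  · rintro a ha ε ⟨hxa, h, hz, hu⟩
    refine Runs.seq (.assign ⟨⟨trivial, trivial⟩, ⟨trivial, ⟨trivial, trivial⟩, ⟨trivial, trivial⟩⟩,
      ⟨trivial, ⟨trivial, trivial⟩, ⟨trivial, trivial⟩⟩⟩ <| .seq <|
      .loop (fun c ε' => ε'.reg 14 = a ∧ ε'.reg 16 = c ∧ I.Ctx ε' ∧ ε'.mem = ε.mem ∧
        (ε'.reg 18 = 0 ↔ I.Allowed ⟨a, ha⟩ ∧ ∀ d : Fin m, d < c → d ∉ I.χ ⟨a, ha⟩)) m_le_size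
      (fun _ _ h => h.2.2.1.reg2) ⟨?_, by simp, (h.set (by decide) _).set (by decide) _, rfl, ?_⟩
      ?_ ?_)
    · simp [Env.set_reg, hxa]
    · have h1 := eval_eqTest (ε := ε) (.var 14) (.var 3)
      have h2 := eval_eqTest (ε := ε) (.var 14) (.var 5)
      have h3 : (Expr.rd (.add (.var 9) (.var 14))).eval ε = if (⟨a, ha⟩ : Fin n) ∈ I.U then 1 else 0 := by
        simp only [Expr.eval, h.reg9, hxa]
        rw [h.input _ (lt_size_of_lt_pathBase (by rw [pathBase]; omega))]
        exact I.cell_forbidden ⟨a, ha⟩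
      simp only [Expr.eval, hxa, h.reg3, h.reg5] at h1 h2
      rw [Env.set_reg_of_ne _ _ (by decide), Env.set_reg_self, Expr.eval, Expr.eval, h3,
        Nat.add_eq_zero_iff, Nat.add_eq_zero_iff, not_ne_iff.symm.trans (not_congr h1),
        not_ne_iff.symm.trans (not_congr h2)]
      simp [Allowed, Fin.ext_iff]
    · rintro c hc ε₁ ⟨hxa, hxc, h, hm, h18⟩
      refine .assign ⟨trivial, bounded_colorAt trivial trivial ?_⟩
        ⟨?_, ?_, by simp, (h.set (by decide) _).set (by decide) _, hm, ?_⟩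
      · simpa only [Expr.eval, hxa] using ha.le.trans n_le_size
      · rwa [Env.set_reg_of_ne _ _ (by decide)]
      · rwa [Env.set_reg_of_ne _ _ (by decide), Env.set_reg_of_ne _ _ (by decide)]
      · rw [Env.set_reg_of_ne _ _ (by decide), Env.set_reg_self, Expr.eval,
          h.eval_colorAt (x := .var 14) (y := .var 16) (a := ⟨a, ha⟩) (c := ⟨c, hc⟩) hxa hxc,
          Nat.add_eq_zero_iff, Expr.eval, h18, and_assoc]
        refine and_congr_right fun _ => ⟨fun ⟨h1, h2⟩ d hd => ?_, fun h1 => ⟨fun d hd => h1 d (by omega), ?_⟩⟩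
        · rcases Nat.lt_succ_iff_lt_or_eq.1 hd with hd | hd
          · exact h1 d hd
          · obtain rfl : d = ⟨c, hc⟩ := Fin.ext hd
            simpa using h2
        · simpa using h1 ⟨c, hc⟩ (by simp)
    · rintro ε₁ ⟨hxa, -, h, hm, h18⟩
      refine .write ⟨trivial, trivial⟩ trivial ⟨hxa, by simp, (h.write ?_ _).set (by decide) _, ?_, ?_⟩
      · simp only [Expr.eval, h.reg11]; omega
      · intro b hb
        simp only [Env.set_mem, Env.write_mem, Expr.eval, h.reg11, hxa]
        rw [if_neg (by omega), hm, hz b hb]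
      · intro w hw
        simp only [Env.set_mem, Env.write_mem, Expr.eval, h.reg11, hxa]
        rcases Nat.lt_succ_iff_lt_or_eq.1 hw with hw | hw
        · rw [if_neg (by omega), hm, hu w hw]
        · obtain rfl : w = ⟨a, ha⟩ := Fin.ext hw
          rw [if_pos rfl, h18, and_comm, Finset.eq_empty_iff_forall_notMem]
          simp
  · rintro ε ⟨-, h, hz, hu⟩
    exact ⟨h, fun c hc => by simp [hz c (by omega)], fun w hw => by
      simp [add_assoc, hz (m + w) (by omega)], fun w => hu w w.2⟩

/-- Set register 18 if a marked colour is on the path in register 19, which has as many vertices as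
register 20 says. -/
def scanCmd : Cmd :=
  .loop 23 20 (.loop 16 2 (.cond (colorAt (.rd (.add (.add (.var 19) (.lit 1)) (.var 23))) (.var 16))
    (.assign 18 (.add (.var 18) (.rd (.add (.var 0) (.var 16)))))))

theorem length_support_le_size {i : ℕ} (hi : i < I.paths.length) :
    I.pathAddr i + 1 + I.paths[i].1.support.length ≤ I.size := by
  rw [← I.pathAddr_succ hi]; exact I.pathAddr_le _

/-- The situation while path number `i` is scanned. -/
structure Scan (I : Instance n m) (M F : Set ℕ) (i : Fin I.paths.length) (ans : ℕ) (ε : Env) : Prop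
    extends I.Tables M F ε where
  reg19 : ε.reg 19 = I.pathAddr i
  reg20 : ε.reg 20 = I.paths[i].1.support.length
  reg21 : ε.reg 21 = ans
  reg22 : ε.reg 22 = i

variable {i : Fin I.paths.length} {ans : ℕ}

theorem Scan.set (h : I.Scan M F i ans ε) {x : Fin 40} (hx : x = 16 ∨ x = 18 ∨ x = 23) (a : ℕ) :
    I.Scan M F i ans (ε.set x a) := by
  refine ⟨h.toTables.set ?_ a, ?_, ?_, ?_, ?_⟩
  · rcases hx with rfl | rfl | rfl <;> decide
  all_goals rw [Env.set_reg_of_ne _ _ (by rcases hx with rfl | rfl | rfl <;> decide)]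
  exacts [h.reg19, h.reg20, h.reg21, h.reg22]

/-- The loops form a disjunction, treated as a union of subsets of `Unit`: register 18 is nonzero
exactly when the union is nonempty. -/
theorem runs_scanCmd (q : Fin m → Prop) (h : I.Scan (natSet q) F i ans ε) (h18 : ε.reg 18 = 0) :
    Runs I.size scanCmd ε fun ε' => I.Scan (natSet q) F i ans ε' ∧
      (ε'.reg 18 = 0 ↔ ∀ c ∈ walkColors I.χ I.paths[i].1, ¬ q c) := by
  let D : ℕ → ℕ → Set Unit := fun j c => {_u | ∃ (hj : j < I.paths[i].1.support.length) (hc : c < m),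
    ⟨c, hc⟩ ∈ I.χ I.paths[i].1.support[j] ∧ q ⟨c, hc⟩}
  have hlen : I.pathAddr i + 1 + I.paths[i].1.support.length ≤ I.size := length_support_le_size i.2
  have hmain : Runs I.size scanCmd ε fun ε' => I.Scan (natSet q) F i ans ε' ∧ (ε'.reg 18 ≠ 0 ↔
      (∅ ∪ {u | ∃ j < I.paths[i].1.support.length, u ∈ {u | ∃ c < m, u ∈ D j c}}).Nonempty) := by
    refine Runs.loop_union (fun S ε => I.Scan (natSet q) F i ans ε ∧ (ε.reg 18 ≠ 0 ↔ S.Nonempty)) _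
      (le_trans (by simp) hlen) (fun S ε h => h.1.reg20) (fun S ε a h => ⟨h.1.set (by simp) a, by
        rw [Env.set_reg_of_ne _ _ (by decide)]; exact h.2⟩) ⟨h, by simp [h18]⟩ ?_
    intro j hj S ε h hxj
    refine (Runs.loop_union (fun S ε => (I.Scan (natSet q) F i ans ε ∧ (ε.reg 18 ≠ 0 ↔ S.Nonempty)) ∧
      ε.reg 23 = j) (D j) m_le_size (fun S ε h => h.1.1.reg2) (fun S ε a h =>
        ⟨⟨h.1.1.set (by simp) a, by rw [Env.set_reg_of_ne _ _ (by decide)]; exact h.1.2⟩, by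
        rw [Env.set_reg_of_ne _ _ (by decide)]; exact h.2⟩) ⟨h, hxj⟩ ?_).mono fun ε h => ⟨h.2, h.1⟩
    rintro c hc S ε ⟨⟨h, h18⟩, hxj⟩ hxc
    have hv : (Expr.rd (.add (.add (.var 19) (.lit 1)) (.var 23))).eval ε =
        I.paths[i].1.support[j] := by
      simp only [Expr.eval, h.reg19, hxj]
      rw [h.input _ (by omega)]
      exact I.cell_path_vertex i.2 hj
    have hq : (Expr.rd (.add (.var 0) (.var 16))).eval ε ≠ 0 ↔ q ⟨c, hc⟩ := by
      simp only [Expr.eval, h.reg0, hxc]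
      rw [h.mark c hc]
      exact ⟨fun ⟨_, h⟩ => h, fun h => ⟨hc, h⟩⟩
    have hcol := h.eval_colorAt (y := .var 16) (c := ⟨c, hc⟩) hv hxc
    refine Runs.cond (bounded_colorAt ⟨⟨trivial, trivial⟩, trivial⟩ trivial ?_) (fun h1 => ?_)
      fun h1 => ⟨hxc, ⟨h, ?_⟩, hxj⟩
    · rw [hv]; exact (Fin.is_lt _).le.trans n_le_size
    · refine Runs.assign ⟨trivial, trivial, trivial⟩ ⟨?_, ⟨h.set (by simp) _, ?_⟩, ?_⟩
      · rwa [Env.set_reg_of_ne _ _ (by decide)]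
      · have hcol' : (⟨c, hc⟩ : Fin m) ∈ I.χ I.paths[i].1.support[j] := by simpa [hcol] using h1
        have hD : (D j c).Nonempty ↔ q ⟨c, hc⟩ := by
          simp only [D, Set.Nonempty, Set.mem_ofPred_eq]
          exact ⟨fun ⟨_, _, _, _, h⟩ => h, fun h => ⟨(), hj, hc, hcol', h⟩⟩
        rw [Env.set_reg_self, Set.union_nonempty, hD, ← h18, ← hq, Expr.eval, Expr.eval]
        omega
      · rwa [Env.set_reg_of_ne _ _ (by decide)]
    · have hcol' : (⟨c, hc⟩ : Fin m) ∉ I.χ I.paths[i].1.support[j] := by simpa [hcol] using h1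
      have hD : D j c = ∅ := by
        refine Set.eq_empty_of_forall_notMem ?_
        rintro u ⟨_, _, h', -⟩
        exact hcol' h'
      rw [hD, Set.union_empty, h18]
  refine hmain.mono fun ε' ⟨h, h'⟩ => ⟨h, ?_⟩
  rw [← not_iff_not, ← Ne, h', not_forall]
  simp only [D, Set.empty_union, Set.Nonempty, Set.mem_ofPred_eq]
  constructor
  · rintro ⟨-, j, hj, c, hc, _, _, h1, h2⟩
    refine ⟨⟨c, hc⟩, fun h => h ?_ h2⟩
    exact mem_walkColors.2 ⟨_, List.getElem_mem hj, h1⟩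
  · rintro ⟨c, hc⟩
    push Not at hc
    obtain ⟨w, hw, hcw⟩ := mem_walkColors.1 hc.1
    obtain ⟨j, hj, rfl⟩ := List.getElem_of_mem hw
    exact ⟨(), j, hj, c, c.2, hj, c.2, hcw, hc.2⟩

/-- Look for a path without marked colours. -/
def outputCmd : Cmd :=
  .seq (.assign 19 (.add (.var 9) (.var 1))) <| .seq (.assign 21 (.lit 0)) <|
  .seq (.loop 22 7 (.seq (.assign 20 (.rd (.var 19))) <| .seq (.assign 18 (.lit 0)) <|
    .seq scanCmd <| .seq (.cond (.sub (.lit 1) (.var 18)) (.assign 21 (.var 22)))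
    (.assign 19 (.add (.add (.var 19) (.lit 1)) (.var 20))))) (.assign 0 (.var 21))

/-- Register 21 starts at the default `0`, a legal position in a nonempty list, and is overwritten
at every good path. A legal position thus comes out even if there is no good path, as may happen
when `t` is forbidden and every path will do. -/
theorem runs_outputCmd (q : Fin m → Prop) (h : I.Tables (natSet q) F ε) (hN : 0 < I.paths.length) :
    Runs I.size outputCmd ε fun ε' => ∃ h : ε'.reg 0 < I.paths.length,
      (∃ i : Fin I.paths.length, ∀ c ∈ walkColors I.χ I.paths[i].1, ¬ q c) →
        ∀ c ∈ walkColors I.χ (I.paths[ε'.reg 0]'h).1, ¬ q c := by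
  let good : ℕ → Prop := fun i => ∃ hi : i < I.paths.length,
    ∀ c ∈ walkColors I.χ I.paths[i].1, ¬ q c
  refine Runs.seq (.assign ⟨trivial, trivial⟩ <| .seq <| .assign trivial <| .seq <|
    .loop (fun i ε => I.Tables (natSet q) F ε ∧ ε.reg 22 = i ∧ ε.reg 19 = I.pathAddr i ∧
      ε.reg 21 < I.paths.length ∧ ∀ i' < i, good i' → good (ε.reg 21)) length_le_size
      (fun _ _ h => h.1.reg7) ⟨?_, by simp, ?_, ?_, by simp⟩ ?_ ?_)
  · exact ((h.set (by decide) _).set (by decide) _).set (by decide) _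
  · simp [Env.set_reg, Expr.eval, h.reg9, h.reg1, pathAddr, pathBase]
  · simpa [Env.set_reg, Expr.eval] using hN
  · rintro i hi ε ⟨h, h22, h19, h21, hg⟩
    have h20 : (Expr.rd (.var 19)).eval ε = I.paths[i].1.support.length := by
      have := length_support_le_size hi
      rw [Expr.eval, Expr.eval, h19, h.input _ (by omega), I.cell_path_length hi]
    refine .seq <| .assign trivial <| .seq <| .assign trivial <| .seq <|
      (runs_scanCmd (F := F) (i := ⟨i, hi⟩) (ans := ε.reg 21) q ⟨(h.set (by decide) _).set (by decide) _,
        ?_, ?_, ?_, ?_⟩ ?_).mono ?_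
    · simpa [Env.set_reg] using h19
    · simpa [Env.set_reg] using h20
    · simp [Env.set_reg]
    · simpa [Env.set_reg] using h22
    · simp [Expr.eval]
    rintro ε₁ ⟨h₁, h18⟩
    have hgi : ε₁.reg 18 = 0 ↔ good i := h18.trans ⟨fun h => ⟨hi, h⟩, fun ⟨_, h⟩ => h⟩
    refine .seq <| .mono (Q' := fun ε₂ => I.Tables (natSet q) F ε₂ ∧ ε₂.reg 22 = i ∧
      ε₂.reg 19 = I.pathAddr i ∧ ε₂.reg 20 = I.paths[i].1.support.length ∧
      ε₂.reg 21 < I.paths.length ∧ ∀ i' < i + 1, good i' → good (ε₂.reg 21))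
      (.cond ⟨trivial, trivial⟩ (fun hc => .assign trivial ?_) fun hc => ?_) ?_
    · have hr : (ε₁.set 21 ((Expr.var 22).eval ε₁)).reg 21 = i := by
        rw [Env.set_reg_self]; exact h₁.reg22
      have hgood : good i := hgi.1 (by simp only [Expr.eval] at hc; omega)
      refine ⟨h₁.toTables.set (by decide) _, ?_, ?_, ?_, hr ▸ hi, fun _ _ _ => hr ▸ hgood⟩
      · rw [Env.set_reg_of_ne _ _ (by decide)]; exact h₁.reg22
      · rw [Env.set_reg_of_ne _ _ (by decide)]; exact h₁.reg19
      · rw [Env.set_reg_of_ne _ _ (by decide)]; exact h₁.reg20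
    · have hgood : ¬ good i := fun h => by
        have := hgi.2 h
        simp only [Expr.eval] at hc; omega
      refine ⟨h₁.toTables, h₁.reg22, h₁.reg19, h₁.reg20, h₁.reg21 ▸ h21, fun i' hi' h' => ?_⟩
      rw [h₁.reg21]
      rcases Nat.lt_succ_iff_lt_or_eq.1 hi' with hi' | rfl
      exacts [hg i' hi' h', absurd h' hgood]
    · rintro ε₂ ⟨h, h22, h19, h20, h21, hg⟩
      refine .assign ⟨⟨trivial, trivial⟩, trivial⟩
        ⟨?_, (h.set (by decide) _).set (by decide) _, by simp, ?_, ?_, ?_⟩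
      · simpa [Env.set_reg] using h22
      · simp [Env.set_reg, Expr.eval, h19, h20, I.pathAddr_succ hi]
      · simpa [Env.set_reg] using h21
      · simpa [Env.set_reg] using hg
  · rintro ε ⟨-, -, -, h21, hg⟩
    refine .assign trivial ?_
    have hr : (ε.set 0 ((Expr.var 21).eval ε)).reg 0 = ε.reg 21 := by rw [Env.set_reg_self]; rfl
    refine ⟨hr ▸ h21, fun ⟨i, hi⟩ => ?_⟩
    obtain ⟨_, h'⟩ := hg i i.2 ⟨i.2, hi⟩
    simpa only [hr] using h'

/-- The algorithm. -/
def searchCmd : Cmd :=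
  .seq setupCmd <| .seq usableCmd <| .seq (.write (.add (.var 10) (.var 4)) (.lit 1)) <|
  .seq roundsCmd outputCmd

theorem runs_searchCmd (hk : I.k ≤ I.size) (hN : 0 < I.paths.length) (h0 : ε.reg 0 = I.size)
    (hm : ε.mem = I.cell) :
    Runs I.size searchCmd ε fun ε' => ∃ h : ε'.reg 0 < I.paths.length,
      (∃ i : Fin I.paths.length, ∀ c ∈ walkColors I.χ I.paths[i].1,
        ¬ ∃ j < I.k, marked I.G I.χ I.Allowed I.t j c) →
      ∀ c ∈ walkColors I.χ (I.paths[ε'.reg 0]'h).1, ¬ ∃ j < I.k, marked I.G I.χ I.Allowed I.t j c := by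
  refine .seq <| (runs_setupCmd h0 hm).mono fun ε ⟨h, hm⟩ => .seq <|
    (runs_usableCmd h hm).mono fun ε h => .seq <| .write ⟨trivial, trivial⟩ trivial <| .seq <|
    (runs_roundsCmd hk ?_).mono fun ε ⟨F, h⟩ => runs_outputCmd _ h hN
  have := h.write_found I.t.2
  simpa only [Expr.eval, h.reg10, h.reg4, Set.empty_union] using this

/-- The number `k` fills a single cell and could be huge, but there are more than `k` paths, and
each occupies cells of the input. Hence `k` rounds are polynomially many. -/
theorem Admissible.k_le_size (hI : I.Admissible) : I.k ≤ I.size := by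
  have hb := hI.b_pos
  have h1 : I.k ≤ 8 * I.k ^ 2 + 8 * I.k + 2 := by nlinarith [sq_nonneg I.k]
  have h2 : 8 * I.k ^ 2 + 8 * I.k + 2 ≤ (8 * I.k ^ 2 + 8 * I.k + 2) * (I.U.card + 1) * I.b := by
    rw [mul_assoc]
    exact Nat.le_mul_of_pos_right _ (by positivity)
  exact (h1.trans h2).trans (hI.many.le.trans length_le_size)

/-- By monotonicity the last index `k - 1` covers all earlier ones. For `k = 0` a valid path has no
colours and both sides are vacuous. -/
theorem Admissible.unmarked_iff (hI : I.Admissible) (i : Fin I.paths.length) :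
    (∀ c ∈ walkColors I.χ I.paths[i].1, ¬ ∃ j < I.k, marked I.G I.χ I.Allowed I.t j c) ↔
      ∀ c ∈ walkColors I.χ I.paths[i].1, ¬ marked I.G I.χ I.Allowed I.t (I.k - 1) c := by
  refine forall₂_congr fun c hc => not_congr ⟨fun ⟨j, hj, h⟩ => marked_mono (by omega) h, fun h => ?_⟩
  have : 0 < I.k := (Finset.card_pos.2 ⟨c, hc⟩).trans_le (hI.valid _ (List.getElem_mem i.2))
  exact ⟨I.k - 1, by omega, h⟩

end Instance
end ColoredPath

theorem mainTheorem5 :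
    ∃ (prog : RAM.Prog) (p : Polynomial ℕ), ∀ (n m : ℕ) (I : ColoredPath.Instance n m),
      I.Admissible →
      ∃ (σ : RAM.State) (T : ℕ),
        RAM.Exec prog (RAM.init I.encode) σ T ∧ T ≤ p.eval I.encode.length ∧
        -- on halting, register 0 holds the position in the list of a path as required
        ∃ h : σ.reg 0 < I.paths.length,
          ∀ Q : I.G.Walk I.v I.t, ColoredPath.IsValid I.χ I.k Q →
            -- `Q` meets `U ∪ {s, v}` only in its first vertex `v`
            (∀ w ∈ Q.support.tail, w ∉ I.U ∧ w ≠ I.s ∧ w ≠ I.v) →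
            Disjoint (ColoredPath.walkColors I.χ (I.paths[σ.reg 0]'h).1)
              (ColoredPath.walkColors I.χ Q) := by
  refine ⟨ColoredPath.Instance.searchCmd.compile, ColoredPath.Instance.searchCmd.cost,
    fun n m I hI => ?_⟩
  have hN := hI.two_le_length
  obtain ⟨σ, T, he, hT, h, hg⟩ := ColoredPath.Instance.runs_searchCmd
    (ε := (RAM.init I.encode).env) hI.k_le_size (by omega) (by simp [RAM.State.env, RAM.init,
      ColoredPath.Instance.size]) rfl _ rfl
  refine ⟨σ, T, he, hT, h, fun Q hQ hQA => ?_⟩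
  refine hI.disjoint_of_unmarked (i := ⟨σ.reg 0, h⟩) (fun ht => ?_) Q hQ hQA
  obtain ⟨i, hi⟩ := hI.exists_unmarked ht
  exact (hI.unmarked_iff ⟨σ.reg 0, h⟩).1 (hg ⟨i, (hI.unmarked_iff i).2 hi⟩)
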